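/- Let $\mathcal K_2$ be Kleene's second algebra (carrier $\mathbb N^{\mathbb N}$) and $\mathcal K_2^{\mathrm{rec}}$ its computable elements. Let $\mathsf{Asm}$ be the category of assemblies over $\mathcal K_2$ with the maps tracked by codes in $\mathcal K_2^{\mathrm{rec}}$, $\mathsf{Mod}$ its full subcategory of modest sets, and $\mathsf{pAsm}$, $\mathsf{pMod}$ the full subcategories of partitioned objects (every element has exactly one realizer), which are up to isomorphism the regular projectives of $\mathsf{Asm}$ and $\mathsf{Mod}$. Containers. A container over a category $\mathcal C$ is a morphism of $\mathcal C$. For $P:X\to U$ and $Q:Y\to V$ write $P\le Q$ if there are $\varphi:U\to V$ and a map $\psi$ over $U$ from a pullback of $Q$ along $\varphi$ to $X$. In a locally cartesian closed category the composition product $P\star Q$ is the composite $E'\to E\to D$, where $D\to V$ is the dependent product $\Pi_Q(\pi_2:U\times Y\to Y)$, $E$ is its pullback along $Q$, $\varepsilon:E\to U\times Y$ is the counit, and $E'$ is the pullback of $P$ along $\pi_1\varepsilon$. For $(\mathcal C,p\mathcal C)\in\{(\mathsf{Mod},\mathsf{pMod}),(\mathsf{Asm},\mathsf{pAsm})\}$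 and $P,Q$ containers over $p\mathcal C$, a sequential product $P\star_p Q$ is a container over $p\mathcal C$ that is a pullback of $P\star Q$ (formed in $\mathcal C$) along a regular projective cover of its codomain. Weihrauch problems. A Weihrauch problem is a map $f:\mathbb N^{\mathbb N}\to\mathcal P(\mathbb N^{\mathbb N})$, with $\operatorname{dom} f=\{i\mid f(i)\neq\emptyset\}$; $f\le_{\mathrm W}g$ if there are partial type-2 computable $\varphi,\psi$ such that for all $i\in\operatorname{dom}f$: $\varphi(i)\in\operatorname{dom}g$ and $\psi(i,j)\in f(i)$ for all $j\in g(\varphi(i))$. The problem $f\sqcap g$ takes a pair of inputs for $f$ and $g$ and asks for a tagged answer to one of them. The problem $f\star g$ takes a pair $\langle i,c\rangle$ with $i\in\operatorname{dom}g$ and $c\cdot y\in\operatorname{dom}f$ for all $y\in g(i)$, and asks for a pair $\langle y,x\rangle$ with $y\in g(i)$ and $x\in f(c\cdot y)$. Extended Weihrauch degrees. An extended Weihrauch predicate is a map $p:\mathbb N^{\mathbb N}\to\mathcal P(\mathcal P(\mathbb N^{\mathbb N}))$, with support $\{r\mid p(r)\neq\emptyset\}$; $p\le q$ if there are $e,e'\in\mathcal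 K_2^{\mathrm{rec}}$ such that for all $r$ in the support of $p$, $e\cdot r$ is defined and in the support of $q$, and for every $\theta\in p(r)$ there is $\xi\in q(e\cdot r)$ with $e'\cdot r\cdot s$ defined and in $\theta$ for all $s\in\xi$. To $p$ corresponds the container $\widehat p:(r,\theta,s)\mapsto(r,\theta)$ over $\mathsf{pAsm}$, where $\theta\in p(r)$, $s\in\theta$, and the realizers are $\langle r,s\rangle$ and $r$. The degree of $s$ is the product $p\star q$ if $\widehat s$ is equivalent, for $\le$ in both directions, to a $\widehat p\star_p\widehat q$. **Corollary.** The inequality $$(a\star b)\sqcap c\ \le\ (a\sqcap c)\star b$$ holds 1. in the Weihrauch degrees (Weihrauch problems under $\le_{\mathrm W}$); 2. in the extended Weihrauch degrees (extended Weihrauch predicates under $\le$); 3. in the preorder of containers over $\mathsf{pMod}$ and in that of containers over $\mathsf{pAsm}$, with $\star=\star_p$. In 2 and 3, $\sqcap$ is the greatest lower bound; all the binary $\sqcap$ and $\star$ exist, and the inequality holds for every choice of representatives of the meets and of the products. -/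

import Mathlib

open CategoryTheory CategoryTheory.Limits

universe v u

/-! ## Kleene's second algebra and its computable part -/

/-- Baire space, the carrier of Kleene's second algebra. -/
abbrev Baire : Type := ℕ → ℕ

namespace Baire

/-- The finite prefix `p 0, …, p (k - 1)`. -/
def pre (p : Baire) (k : ℕ) : List ℕ := (List.range k).map p

/-- The standard (interleaving) pairing of Baire space. -/
def pair (p q : Baire) : Baire := fun n => if n % 2 = 0 then p (n / 2) else q (n / 2)

/-- The sequence `n, p 0, p 1, …`. -/
def cons (n : ℕ) (p : Baire) : Baire := fun m => Nat.casesOn m n p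

end Baire

/-- Application of Kleene's second algebra: `K2App a p q` says that `a · p` is defined and equal to
`q`. The value `(a · p) n` is `m` when `a` takes the value `m + 1` at (the code of) the first word
`n, p 0, …, p (k - 1)` at which it is not `0`. -/
def K2App (a p q : Baire) : Prop :=
  ∀ n, ∃ k, a (Encodable.encode (n :: p.pre k)) = q n + 1 ∧
    ∀ j < k, a (Encodable.encode (n :: p.pre j)) = 0

/-! Helper facts: identity, first projection and composition have computable codes. -/

namespace K2

/-- The code with value `G n σ` at the word `n :: σ`. -/
def ofWord (G : ℕ → List ℕ → ℕ) : Baire := fun m =>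
  G (Denumerable.ofNat (List ℕ) m).headI (Denumerable.ofNat (List ℕ) m).tail

theorem ofWord_encode (G : ℕ → List ℕ → ℕ) (n : ℕ) (σ : List ℕ) :
    ofWord G (Encodable.encode (n :: σ)) = G n σ := by
  simp [ofWord]

theorem ofWord_computable {G : ℕ → List ℕ → ℕ} (hG : Computable₂ G) :
    Computable (ofWord G) := by
  have h := Computable.ofNat (List ℕ)
  exact hG.comp (Primrec.list_headI.to_comp.comp h) (Primrec.list_tail.to_comp.comp h)

theorem pre_length (p : Baire) (k : ℕ) : (p.pre k).length = k := by simp [Baire.pre]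

theorem pre_succ (p : Baire) (k : ℕ) : p.pre (k + 1) = p.pre k ++ [p k] := by
  simp [Baire.pre, List.range_succ]

theorem pre_take (p : Baire) {j k : ℕ} (h : j ≤ k) : (p.pre k).take j = p.pre j := by
  simp [Baire.pre, ← List.map_take, List.take_range, h]

theorem pre_getElem? (p : Baire) (k n : ℕ) :
    (p.pre k)[n]? = if n < k then some (p n) else none := by
  by_cases h : n < k
  · simp [Baire.pre, h]
  · simp [Baire.pre, h]

/-- To compute `q` from `p` it suffices to emit correct values, eventually for every argument. -/
theorem app_ofWord {G : ℕ → List ℕ → ℕ} {p q : Baire}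
    (h1 : ∀ n k, G n (p.pre k) = 0 ∨ G n (p.pre k) = q n + 1)
    (h2 : ∀ n, ∃ k, G n (p.pre k) ≠ 0) : K2App (ofWord G) p q := by
  classical
  intro n
  refine ⟨Nat.find (h2 n), ?_, fun j hj => ?_⟩
  · rw [ofWord_encode]
    exact (h1 n _).resolve_left (Nat.find_spec (h2 n))
  · rw [ofWord_encode]
    exact not_not.mp (Nat.find_min (h2 n) hj)

/-- The code that copies the entries selected by `s`. -/
theorem exists_select (s : ℕ → ℕ) (hs : Computable s) :
    ∃ e : Baire, Computable e ∧ ∀ p : Baire, K2App e p (fun n => p (s n)) := by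
  refine ⟨ofWord fun n σ => Option.casesOn (σ[s n]?) 0 fun m => m + 1, ?_, fun p => ?_⟩
  · apply ofWord_computable
    exact Computable.option_casesOn (o := fun x : ℕ × List ℕ => x.2[s x.1]?)
      (f := fun _ => 0) (g := fun _ m => m + 1)
      (Computable.list_getElem?.comp Computable.snd (hs.comp Computable.fst))
      (Computable.const 0) (Computable.succ.comp Computable.snd)
  · apply app_ofWord
    · intro n k
      rw [pre_getElem?]
      by_cases h : s n < k <;> simp [h]
    · intro n
      refine ⟨s n + 1, ?_⟩
      rw [pre_getElem?]
      simp

/-- The first non-zero value of `a` at the words `n :: σ.take j`, `j < K`, or `0`. -/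
def search (a : Baire) (n : ℕ) (σ : List ℕ) (K : ℕ) : ℕ :=
  Nat.rec 0 (fun j r => Nat.casesOn r (a (Encodable.encode (n :: σ.take j))) fun m => m + 1) K

theorem search_computable {a : Baire} (ha : Computable a) :
    Computable fun x : (ℕ × List ℕ) × ℕ => search a x.1.1 x.1.2 x.2 := by
  unfold search
  refine Computable.nat_rec (f := fun x : (ℕ × List ℕ) × ℕ => x.2) (g := fun _ => 0)
    (h := fun x y => Nat.casesOn y.2 (a (Encodable.encode (x.1.1 :: x.1.2.take y.1)))
      fun m => m + 1) Computable.snd (Computable.const 0) ?_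
  refine Computable.nat_casesOn (f := fun z : ((ℕ × List ℕ) × ℕ) × (ℕ × ℕ) => z.2.2)
    (g := fun z => a (Encodable.encode (z.1.1.1 :: z.1.1.2.take z.2.1)))
    (h := fun _ m => m + 1) (Computable.snd.comp Computable.snd) ?_
    (Computable.succ.comp Computable.snd)
  refine ha.comp (Computable.encode.comp (Computable.list_cons.comp ?_ ?_))
  · exact Computable.fst.comp (Computable.fst.comp Computable.fst)
  · exact Primrec.list_take.to_comp.comp (Computable.fst.comp Computable.snd)
      (Computable.snd.comp (Computable.fst.comp Computable.fst))

theorem search_computable' {a : Baire} (ha : Computable a) {α : Type} [Primcodable α]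
    {f : α → ℕ} {g : α → List ℕ} {h : α → ℕ} (hf : Computable f) (hg : Computable g)
    (hh : Computable h) : Computable fun x => search a (f x) (g x) (h x) :=
  Computable.comp (f := fun x : (ℕ × List ℕ) × ℕ => search a x.1.1 x.1.2 x.2)
    (g := fun x => ((f x, g x), h x)) (search_computable ha)
    (Computable.pair (Computable.pair hf hg) hh)

theorem search_eq {a p q : Baire} {n k : ℕ}
    (hk : a (Encodable.encode (n :: p.pre k)) = q n + 1)
    (hj : ∀ j < k, a (Encodable.encode (n :: p.pre j)) = 0) (L K : ℕ) (hK : K ≤ L + 1) :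
    search a n (p.pre L) K = if k < K then q n + 1 else 0 := by
  induction K with
  | zero => simp [search]
  | succ K ih =>
    have ih := ih (by omega)
    have hs : search a n (p.pre L) (K + 1) = Nat.casesOn (search a n (p.pre L) K)
        (a (Encodable.encode (n :: (p.pre L).take K))) fun m => m + 1 := rfl
    rw [hs, ih, pre_take p (by omega : K ≤ L)]
    rcases lt_trichotomy k K with h | h | h
    · simp [h, Nat.lt_succ_of_lt h]
    · subst h; rw [if_neg (lt_irrefl _), if_pos (Nat.lt_succ_self _)]; exact hk
    · rw [if_neg (by omega), if_neg (by omega)]; exact hj K h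

/-- The longest prefix of `b · p` that is found from the prefix `σ` of `p` in `K` steps. -/
def run (b : Baire) (σ : List ℕ) (K : ℕ) : List ℕ :=
  Nat.rec [] (fun _ ρ => Nat.casesOn (search b ρ.length σ (σ.length + 1)) ρ fun m => ρ ++ [m]) K

theorem run_computable {b : Baire} (hb : Computable b) :
    Computable fun x : List ℕ × ℕ => run b x.1 x.2 := by
  unfold run
  refine Computable.nat_rec (f := fun x : List ℕ × ℕ => x.2) (g := fun _ => ([] : List ℕ))
    (h := fun x y => Nat.casesOn (search b y.2.length x.1 (x.1.length + 1)) y.2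
      fun m => y.2 ++ [m]) Computable.snd (Computable.const []) ?_
  refine Computable.nat_casesOn
    (f := fun z : (List ℕ × ℕ) × (ℕ × List ℕ) =>
      search b z.2.2.length z.1.1 (z.1.1.length + 1))
    (g := fun z => z.2.2) (h := fun z m => z.2.2 ++ [m]) ?_
    (Computable.snd.comp Computable.snd) ?_
  · refine search_computable' hb ?_ ?_ ?_
    · exact Computable.list_length.comp (Computable.snd.comp Computable.snd)
    · exact Computable.fst.comp Computable.fst
    · exact Computable.succ.comp (Computable.list_length.comp (Computable.fst.comp Computable.fst))
  · exact Computable.list_concat.comp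
      (Computable.snd.comp (Computable.snd.comp Computable.fst)) Computable.snd

theorem run_eq {b p q : Baire} (h : K2App b p q) (L K : ℕ) :
    ∃ m ≤ K, run b (p.pre L) K = q.pre m ∧
      ∀ M ≤ K, (∀ n < M, ∃ k ≤ L, b (Encodable.encode (n :: p.pre k)) ≠ 0) → M ≤ m := by
  induction K with
  | zero => exact ⟨0, le_rfl, by simp [run, Baire.pre], fun M hM _ => hM⟩
  | succ K ih =>
    obtain ⟨m, hmK, hrun, hm⟩ := ih
    have hs : run b (p.pre L) (K + 1) = Nat.casesOn
        (search b (run b (p.pre L) K).length (p.pre L) ((p.pre L).length + 1))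
        (run b (p.pre L) K) fun m => run b (p.pre L) K ++ [m] := rfl
    obtain ⟨k, hk, hj⟩ := h m
    rw [hs, hrun, pre_length, pre_length, search_eq hk hj L (L + 1) le_rfl]
    by_cases hkL : k < L + 1
    · refine ⟨m + 1, by omega, by simp [hkL, pre_succ], fun M hM hall => ?_⟩
      by_cases hMK : M ≤ K
      · exact (hm M hMK hall).trans (Nat.le_succ m)
      · have := hm K le_rfl fun n hn => hall n (by omega)
        omega
    · refine ⟨m, by omega, by simp [hkL], fun M hM hall => ?_⟩
      by_contra hlt
      obtain ⟨k', hk', hne⟩ := hall m (by omega)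
      exact hne (hj k' (by omega))

/-- Composition of computable codes. -/
theorem exists_comp {a b : Baire} (ha : Computable a) (hb : Computable b) :
    ∃ c : Baire, Computable c ∧ ∀ p q s : Baire, K2App b p q → K2App a q s → K2App c p s := by
  refine ⟨ofWord fun n σ => search a n (run b σ σ.length) ((run b σ σ.length).length + 1),
    ?_, fun p q s hb' ha' => ?_⟩
  · apply ofWord_computable
    have hr : Computable fun x : ℕ × List ℕ => run b x.2 x.2.length :=
      Computable.comp (f := fun x : List ℕ × ℕ => run b x.1 x.2)
        (g := fun x : ℕ × List ℕ => (x.2, x.2.length)) (run_computable hb)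
        (Computable.pair Computable.snd (Computable.list_length.comp Computable.snd))
    exact search_computable' ha Computable.fst hr
      (Computable.succ.comp (Computable.list_length.comp hr))
  · apply app_ofWord
    · intro n k
      obtain ⟨m, -, hm, -⟩ := run_eq hb' k k
      obtain ⟨k', h1, h2⟩ := ha' n
      rw [pre_length, hm, pre_length, search_eq h1 h2 m (m + 1) le_rfl]
      by_cases h : k' < m + 1 <;> simp [h]
    · intro n
      obtain ⟨k', h1, h2⟩ := ha' n
      have hb2 := hb'
      choose κ hκ _ using hb2
      let L := k' + ∑ i ∈ Finset.range k', κ i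
      refine ⟨L, ?_⟩
      obtain ⟨m, -, hm, hM⟩ := run_eq hb' L L
      have hk'm : k' ≤ m := by
        refine hM k' (Nat.le_add_right _ _) fun i hi => ⟨κ i, ?_, by rw [hκ i]; omega⟩
        exact (Finset.single_le_sum (f := κ) (fun _ _ => Nat.zero_le _)
          (Finset.mem_range.mpr hi)).trans (Nat.le_add_left _ _)
      rw [pre_length, hm, pre_length, search_eq h1 h2 m (m + 1) le_rfl]
      simp [Nat.lt_succ_of_le hk'm]

end K2

/-! ## Weihrauch problems -/

/-- A Weihrauch problem: a partial multivalued function on Baire space. -/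
abbrev WeihrauchProblem : Type := Baire → Set Baire

namespace WeihrauchProblem

/-- The domain of a problem: the inputs with at least one answer. -/
def dom (f : WeihrauchProblem) : Set Baire := {p | (f p).Nonempty}

/-- Weihrauch reducibility. Partial computable maps on Baire space are given, up to restriction, by
computable codes, and `ψ` takes its two arguments as a pair. -/
def Reducible (f g : WeihrauchProblem) : Prop :=
  ∃ φ ψ : Baire, Computable φ ∧ Computable ψ ∧
    ∀ i ∈ f.dom, ∃ i' ∈ g.dom, K2App φ i i' ∧
      ∀ j ∈ g i', ∃ z ∈ f i, K2App ψ (i.pair j) z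

/-- The meet: ask a question to both problems, get a (tagged) answer to one of them. -/
def meet (f g : WeihrauchProblem) : WeihrauchProblem := fun i =>
  {z | ∃ p ∈ f.dom, ∃ q ∈ g.dom, i = p.pair q ∧
    ((∃ x ∈ f p, z = x.cons 0) ∨ (∃ y ∈ g q, z = y.cons 1))}

/-- The composition product `f ⋆ g`: an input is an input `i` of `g` with a code `c` of a function
that turns every answer to `i` into an input of `f`; an answer is an answer `y` to `i` with an
answer to the input `c · y` of `f`. -/
def star (f g : WeihrauchProblem) : WeihrauchProblem := fun w =>
  {z | ∃ i c : Baire, w = i.pair c ∧ i ∈ g.dom ∧ (∀ y ∈ g i, ∃ j ∈ f.dom, K2App c y j) ∧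
    ∃ y ∈ g i, ∃ j, K2App c y j ∧ ∃ x ∈ f j, z = y.pair x}

end WeihrauchProblem

/-! ## Containers over a category -/

namespace Container

variable {C : Type u} [Category.{v} C]

/-- There is a morphism of containers from `P : X ⟶ U` to `Q : Y ⟶ V`: a forward map `φ : U ⟶ V`
and a backward map `ψ` to `X` over `U`, from a pullback `Z` of `Q` along `φ`. This is the preorder
of which the posetal reflection of the category of containers is the quotient. -/
def Reducible (P Q : Arrow C) : Prop :=
  ∃ (φ : P.right ⟶ Q.right) (Z : C) (y : Z ⟶ Q.left) (π : Z ⟶ P.right) (ψ : Z ⟶ P.left),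
    IsPullback y π Q.hom φ ∧ ψ ≫ P.hom = π

/-- `d : D ⟶ V` is the dependent product `Π_Q α` of `α : A ⟶ Y` along `Q : Y ⟶ V`, where `E` is the
pullback of `d` along `Q` and `ε : E ⟶ A` is the counit of the adjunction `Q^* ⊣ Π_Q` at `α`. -/
def IsDependentProduct {A Y V D E : C} (α : A ⟶ Y) (Q : Y ⟶ V) (d : D ⟶ V)
    (toD : E ⟶ D) (toY : E ⟶ Y) (ε : E ⟶ A) : Prop :=
  IsPullback toD toY d Q ∧ ε ≫ α = toY ∧
    ∀ (T T' : C) (t : T ⟶ V) (a : T' ⟶ T) (b : T' ⟶ Y), IsPullback a b t Q →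
      ∀ h : T' ⟶ A, h ≫ α = b →
        ∃! k : T ⟶ D, k ≫ d = t ∧
          ∃ k' : T' ⟶ E, k' ≫ toD = a ≫ k ∧ k' ≫ toY = b ∧ k' ≫ ε = h

/-- `S` is the composition product `P ⋆ Q` of `P : X ⟶ U` and `Q : Y ⟶ V`: with
`π₂ : U × Y ⟶ Y`, `d = Π_Q π₂ : D ⟶ V`, `E = Q^* D` and `ε : E ⟶ U × Y`, it is the composite
`S.left ⟶ E ⟶ D`, where `S.left` is the pullback of `P` along `π₁ ∘ ε`. -/
def IsCompositionProduct (P Q S : Arrow C) : Prop :=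
  ∃ (UY : C) (π₁ : UY ⟶ P.right) (π₂ : UY ⟶ Q.left),
    Nonempty (IsLimit (BinaryFan.mk π₁ π₂)) ∧
    ∃ (d : S.right ⟶ Q.right) (E : C) (toD : E ⟶ S.right) (toY : E ⟶ Q.left) (ε : E ⟶ UY),
      IsDependentProduct π₂ Q.hom d toD toY ε ∧
      ∃ (x : S.left ⟶ P.left) (l : S.left ⟶ E),
        IsPullback x l P.hom (ε ≫ π₁) ∧ S.hom = l ≫ toD

/-- Regular projectivity: the left lifting property against regular epimorphisms. -/
def IsRegularProjective (X : C) : Prop :=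
  ∀ ⦃Z Y : C⦄ (e : Z ⟶ Y), IsRegularEpi e → ∀ f : X ⟶ Y, ∃ g : X ⟶ Z, g ≫ e = f

/-- For containers `P`, `Q` over a full subcategory `p` of projectives of `C`, `T` is a sequential
product `P ⋆_p Q`: the pullback of the composition product `P ⋆ Q` in `C` along a regular
projective cover `ε` of its object of positions. -/
def IsSequentialProduct (p : ObjectProperty C) (P Q T : Arrow p.FullSubcategory) : Prop :=
  ∃ S : Arrow C, IsCompositionProduct (p.ι.mapArrow.obj P) (p.ι.mapArrow.obj Q) S ∧
    ∃ (ε : T.right.obj ⟶ S.right) (δ : T.left.obj ⟶ S.left),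
      IsRegularProjective T.right.obj ∧ IsRegularEpi ε ∧ IsPullback δ T.hom.hom S.hom ε

end Container

/-! ## Assemblies and modest sets -/

/-- An assembly over Kleene's second algebra. -/
structure Assembly where
  /-- the carrier -/
  carrier : Type u
  /-- the realizability relation -/
  Realizes : Baire → carrier → Prop
  /-- every element has a realizer -/
  exists_realizer : ∀ x, ∃ r, Realizes r x

namespace Assembly

/-- The map `f` is tracked by the code `e`. -/
def Tracks {X Y : Assembly.{u}} (e : Baire) (f : X.carrier → Y.carrier) : Prop :=
  ∀ r x, X.Realizes r x → ∃ q, K2App e r q ∧ Y.Realizes q (f x)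

/-- Morphisms: maps that are tracked by a computable code. -/
@[ext]
structure Hom (X Y : Assembly.{u}) where
  /-- the underlying map -/
  fn : X.carrier → Y.carrier
  /-- it is computably tracked -/
  tracked : ∃ e : Baire, Computable e ∧ Tracks e fn

theorem tracked_id (X : Assembly.{u}) :
    ∃ e : Baire, Computable e ∧ Tracks (X := X) (Y := X) e id := by
  obtain ⟨e, he, h⟩ := K2.exists_select id Computable.id
  exact ⟨e, he, fun r x hx => ⟨r, h r, hx⟩⟩

theorem tracked_comp {X Y Z : Assembly.{u}} (f : Hom X Y) (g : Hom Y Z) :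
    ∃ e : Baire, Computable e ∧ Tracks (X := X) (Y := Z) e (g.fn ∘ f.fn) := by
  obtain ⟨b, hb, hf⟩ := f.tracked
  obtain ⟨a, ha, hg⟩ := g.tracked
  obtain ⟨c, hc, h⟩ := K2.exists_comp ha hb
  refine ⟨c, hc, fun r x hx => ?_⟩
  obtain ⟨q, hq, hy⟩ := hf r x hx
  obtain ⟨s, hs, hz⟩ := hg q _ hy
  exact ⟨s, h r q s hq hs, hz⟩

/-- The category of assemblies over Kleene's second algebra, with the maps that are tracked by
computable codes. -/
instance : Category.{u} Assembly.{u} where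
  Hom := Hom
  id X := ⟨id, tracked_id X⟩
  comp f g := ⟨g.fn ∘ f.fn, tracked_comp f g⟩

/-- No code realizes two different elements. -/
def IsModest : ObjectProperty Assembly.{u} := fun X =>
  ∀ r x y, X.Realizes r x → X.Realizes r y → x = y

/-- Every element has at most one realizer. -/
def IsPartitioned : ObjectProperty Assembly.{u} := fun X =>
  ∀ r s x, X.Realizes r x → X.Realizes s x → r = s

end Assembly

/-- The category of modest sets. -/
abbrev ModestSet : Type (u + 1) := Assembly.IsModest.{u}.FullSubcategory

/-- Partitioned modest sets, as a full subcategory of the category of modest sets. -/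
def ModestSet.IsPartitioned : ObjectProperty ModestSet.{u} := fun X =>
  Assembly.IsPartitioned X.obj

/-! ## Extended Weihrauch predicates -/

/-- An extended Weihrauch predicate over Kleene's second algebra. -/
abbrev ExtendedPredicate : Type := Baire → Set (Set Baire)

namespace ExtendedPredicate

/-- The support of an extended Weihrauch predicate. -/
def supp (p : ExtendedPredicate) : Set Baire := {r | (p r).Nonempty}

/-- Reducibility of extended Weihrauch predicates. -/
def Reducible (p q : ExtendedPredicate) : Prop :=
  ∃ fwd bwd : Baire, Computable fwd ∧ Computable bwd ∧
    ∀ r ∈ p.supp, ∃ r' ∈ q.supp, K2App fwd r r' ∧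
      ∀ θ ∈ p r, ∃ ξ ∈ q r', ∀ s ∈ ξ, ∃ c t : Baire, K2App bwd r c ∧ K2App c s t ∧ t ∈ θ

/-- The assembly of positions: pairs `(r, θ)` with `θ ∈ p r`, realized by `r`. -/
def positions (p : ExtendedPredicate) : Assembly.{0} where
  carrier := {x : Baire × Set Baire // x.2 ∈ p x.1}
  Realizes e x := e = x.1.1
  exists_realizer x := ⟨x.1.1, rfl⟩

/-- The assembly of directions: triples `(r, θ, s)` with `s ∈ θ ∈ p r`, realized by the pair of `r`
and `s`. -/
def directions (p : ExtendedPredicate) : Assembly.{0} where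
  carrier := {x : Baire × Set Baire × Baire // x.2.1 ∈ p x.1 ∧ x.2.2 ∈ x.2.1}
  Realizes e x := e = x.1.1.pair x.1.2.2
  exists_realizer _ := ⟨_, rfl⟩

theorem tracked_proj (p : ExtendedPredicate) : ∃ e : Baire, Computable e ∧
    Assembly.Tracks (X := p.directions) (Y := p.positions) e
      (fun x => ⟨(x.1.1, x.1.2.1), x.2.1⟩) := by
  obtain ⟨e, he, h⟩ := K2.exists_select (fun n => n * 2)
    (Primrec.nat_mul.to_comp.comp Computable.id (Computable.const 2))
  refine ⟨e, he, fun r x hx => ⟨x.1.1, ?_, rfl⟩⟩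
  have hr : r = x.1.1.pair x.1.2.2 := hx
  have := h r
  convert this using 1
  funext n
  simp [hr, Baire.pair]

/-- The container over partitioned assemblies that corresponds to an extended Weihrauch predicate:
the projection `(r, θ, s) ↦ (r, θ)`. -/
def toContainer (p : ExtendedPredicate) :
    Arrow Assembly.IsPartitioned.{0}.FullSubcategory :=
  Arrow.mk (ObjectProperty.homMk
    (X := ⟨p.directions, fun _ _ _ h h' => h.trans h'.symm⟩)
    (Y := ⟨p.positions, fun _ _ _ h h' => h.trans h'.symm⟩)
    (⟨fun x => ⟨(x.1.1, x.1.2.1), x.2.1⟩, p.tracked_proj⟩ :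
      Assembly.Hom p.directions p.positions))

/-- The degree of `s` is the sequential product of the degrees of `p` and `q`: the container of `s`
is equivalent to a sequential product of the containers of `p` and `q`. -/
def IsSequentialProduct (p q s : ExtendedPredicate) : Prop :=
  ∃ T, Container.IsSequentialProduct Assembly.IsPartitioned p.toContainer q.toContainer T ∧
    Container.Reducible s.toContainer T ∧ Container.Reducible T s.toContainer

end ExtendedPredicate

/-! ## The inequality for degrees -/

/-- `m` represents the meet of the degrees of `x` and `y`: it is a greatest lower bound of `x` and
`y` for the reducibility `le`. -/
def IsMeet {α : Type*} (le : α → α → Prop) (x y m : α) : Prop :=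
  le m x ∧ le m y ∧ ∀ n, le n x → le n y → le n m

/-- Binary meets and `star` are everywhere defined, and `(a ⋆ b) ⊓ c ≤ (a ⊓ c) ⋆ b`
for all `a`, `b`, `c`, whatever representatives of the meets and of `star` are chosen. -/
def StarMeetInequality {α : Type*} (le : α → α → Prop) (star : α → α → α → Prop) : Prop :=
  (∀ a b, ∃ s, star a b s) ∧ (∀ a b, ∃ m, IsMeet le a b m) ∧
    ∀ a b c ab ab_c ac ac_b, star a b ab → IsMeet le ab c ab_c → IsMeet le a c ac →
      star ac b ac_b → le ab_c ac_b

/-!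
The inequality is formal. Let `a`, `b`, `c` be containers over a class of projectives closed under
pullback. Unfolding the dependent product in `a ⋆ b`, and lifting along the projective cover, a
reduction of `m` to a sequential product of `a` and `b` consists of a map `φ` from the positions of
`m` to those of `b`, a map `θ` to the positions of `a` from the pullback `B` of `b` along `φ`, and a
backward map from the pullback of `a` along `θ` to `m`, over the positions of `m`
(`Container.IsSequentialProduct.reducible_iff`); this does not depend on the representative of the
product. If also `m ≤ c`, then the pullback of `m` to `B` is below `a`, through `θ`, and below `c`,
so it is below `a ⊓ c`, and this is a reduction of `m` to `(a ⊓ c) ⋆ b`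
(`Container.starMeetInequality`).

It remains to see that partitioned objects are such a class and that products and meets exist
(`Container.IsProjectiveBase`). This rests on three facts about Kleene's second algebra, proved by
explicit codes: the s-m-n theorem `K2.exists_curry`, the universal code `K2.exists_universal`, and
definition by cases on a tag `K2.exists_cases`. The first two give dependent products of assemblies,
whose elements are the sections on a fibre that are tracked by a code; the third gives coproducts
stable under pullback, hence meets. A regular epimorphism factors through its image, realized as a
quotient of its domain, so it has computable lifts of realizers and partitioned objects are
projective. All constructions preserve modest sets, so assemblies and modest sets are treated at
once.

Extended Weihrauch predicates embed in the preorder of containers over partitioned assemblies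
(`ExtendedPredicate.reducible_toContainer_iff`), and every such container over small assemblies is
equivalent to one of them (`ExtendedPredicate.exists_equiv_toContainer`), so the inequality is
transferred. For Weihrauch problems, a question `⟨⟨i, c⟩, p⟩` to `(f ⋆ g) ⊓ h` is sent to `⟨i, c'⟩`,
where `c' · y = ⟨c · y, p⟩`.
-/

/-! ### Computable operations on Kleene's second algebra -/

theorem K2App.unique {a p q q' : Baire} (h : K2App a p q) (h' : K2App a p q') : q = q' := by
  funext n
  obtain ⟨k, hk, hlt⟩ := h n
  obtain ⟨k', hk', hlt'⟩ := h' n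
  rcases lt_trichotomy k k' with hkk | rfl | hkk
  · have := hlt' k hkk; omega
  · omega
  · have := hlt k' hkk; omega

namespace Baire

theorem pair_even (p q : Baire) (n : ℕ) : p.pair q (2 * n) = p n := by
  simp [pair]

theorem pair_odd (p q : Baire) (n : ℕ) : p.pair q (2 * n + 1) = q n := by
  have h : (2 * n + 1) / 2 = n := by omega
  simp [pair, h]

theorem pair_inj {p q p' q' : Baire} : p.pair q = p'.pair q' ↔ p = p' ∧ q = q' := by
  refine ⟨fun h => ⟨funext fun n => ?_, funext fun n => ?_⟩, fun h => by rw [h.1, h.2]⟩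
  · rw [← pair_even p q, h, pair_even]
  · rw [← pair_odd p q, h, pair_odd]

theorem cons_inj {m n : ℕ} {p q : Baire} : cons m p = cons n q ↔ m = n ∧ p = q := by
  refine ⟨fun h => ⟨congrFun h 0, funext fun k => congrFun h (k + 1)⟩, fun h => by rw [h.1, h.2]⟩

end Baire

namespace K2

/-- The family `b` is computable from the family `a`, uniformly in the index: a single computable
code sends every `a i` to `b i`. -/
def ComputableFrom {ι : Sort*} (a b : ι → Baire) : Prop :=
  ∃ e : Baire, Computable e ∧ ∀ i, K2App e (a i) (b i)

theorem getD_pre (p : Baire) {k n : ℕ} (h : n < k) : (p.pre k).getD n 0 = p n := by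
  rw [List.getD_eq_getElem?_getD, pre_getElem?, if_pos h, Option.getD_some]

/-- A functional whose value at `n` is computable from the prefix of length `M n` has a computable
code. -/
theorem exists_of_modulus {M : ℕ → ℕ} {H : ℕ → List ℕ → ℕ} (hM : Computable M)
    (hH : Computable₂ H) :
    ∃ e : Baire, Computable e ∧ ∀ p : Baire, K2App e p (fun n => H n (p.pre (M n))) := by
  refine ⟨ofWord fun n σ => if M n ≤ σ.length then H n (σ.take (M n)) + 1 else 0, ?_, fun p => ?_⟩
  · apply ofWord_computable
    have h1 : Computable fun x : ℕ × List ℕ => decide (M x.1 ≤ x.2.length) :=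
      (Primrec.nat_le.decide.to_comp (f := fun a b : ℕ => decide (a ≤ b))).comp
        (hM.comp Computable.fst) (Computable.list_length.comp Computable.snd)
    have h2 : Computable fun x : ℕ × List ℕ => H x.1 (x.2.take (M x.1)) + 1 :=
      Computable.succ.comp (hH.comp Computable.fst
        (Primrec.list_take.to_comp.comp (hM.comp Computable.fst) Computable.snd))
    refine (Computable.cond h1 h2 (Computable.const 0)).of_eq fun x => ?_
    by_cases h : M x.1 ≤ x.2.length <;> simp [h]
  · apply app_ofWord
    · intro n k
      rw [pre_length]
      by_cases h : M n ≤ k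
      · rw [if_pos h, pre_take p h]; exact Or.inr rfl
      · rw [if_neg h]; exact Or.inl rfl
    · intro n
      exact ⟨M n, by rw [pre_length, if_pos le_rfl]; exact Nat.succ_ne_zero _⟩

/-- The prefix of length `2 * |σ|` of the pairing of two sequences with prefixes `ρ` and `σ`. -/
def interleave (ρ σ : List ℕ) : List ℕ :=
  (List.range (2 * σ.length)).map fun i =>
    if i % 2 = 0 then ρ.getD (i / 2) 0 else σ.getD (i / 2) 0

theorem interleave_pre (p q : Baire) (k : ℕ) :
    interleave (p.pre k) (q.pre k) = (p.pair q).pre (2 * k) := by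
  unfold interleave
  rw [pre_length]
  refine List.map_congr_left (g := p.pair q) fun i hi => ?_
  have hi := List.mem_range.1 hi
  rw [getD_pre p (by omega), getD_pre q (by omega)]
  rfl

theorem interleave_primrec : Primrec₂ interleave := by
  refine Primrec.list_map (f := fun x : List ℕ × List ℕ => List.range (2 * x.2.length))
    (g := fun x i => if i % 2 = 0 then x.1.getD (i / 2) 0 else x.2.getD (i / 2) 0) ?_ ?_
  · exact Primrec.list_range.comp
      (Primrec.nat_mul.comp (Primrec.const 2) (Primrec.list_length.comp Primrec.snd))
  · have hd : Primrec fun y : (List ℕ × List ℕ) × ℕ => y.2 / 2 :=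
      Primrec.nat_div.comp Primrec.snd (Primrec.const 2)
    refine Primrec.ite (c := fun y : (List ℕ × List ℕ) × ℕ => y.2 % 2 = 0) ?_ ?_ ?_
    · exact Primrec.eq.comp (Primrec.nat_mod.comp Primrec.snd (Primrec.const 2)) (Primrec.const 0)
    · exact (Primrec.list_getD 0).comp (Primrec.fst.comp Primrec.fst) hd
    · exact (Primrec.list_getD 0).comp (Primrec.snd.comp Primrec.fst) hd

/-- The s-m-n theorem: a computable code applied to pairs can be curried. At a word `n :: σ`, the
curried code runs the search for the value on the prefix of `⟨r, y⟩` given by `σ` and the prefix of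
`r` of the same length as `σ`; so its entries are computed from `r` with a computable modulus. -/
theorem exists_curry {a : Baire} (ha : Computable a) :
    ∃ φ : Baire, Computable φ ∧ ∀ r, ∃ e, K2App φ r e ∧
      ∀ y z, K2App a (r.pair y) z → K2App e y z := by
  have ht : Computable fun m : ℕ => (Denumerable.ofNat (List ℕ) m).tail :=
    Primrec.list_tail.to_comp.comp (Computable.ofNat (List ℕ))
  obtain ⟨φ, hφ, h⟩ := exists_of_modulus
    (M := fun m => (Denumerable.ofNat (List ℕ) m).tail.length)
    (H := fun m ρ => search a (Denumerable.ofNat (List ℕ) m).headI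
      (interleave ρ (Denumerable.ofNat (List ℕ) m).tail)
      (2 * (Denumerable.ofNat (List ℕ) m).tail.length + 1))
    (Computable.list_length.comp ht)
    (search_computable' ha
      (Primrec.list_headI.to_comp.comp ((Computable.ofNat (List ℕ)).comp Computable.fst))
      (interleave_primrec.to_comp.comp Computable.snd (ht.comp Computable.fst))
      (Computable.succ.comp (Primrec.nat_mul.to_comp.comp (Computable.const 2)
        (Computable.list_length.comp (ht.comp Computable.fst)))))
  refine ⟨φ, hφ, fun r => ⟨_, h r, fun y z hz => ?_⟩⟩
  have key : ∀ n k, search a n (interleave (r.pre (y.pre k).length) (y.pre k))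
      (2 * (y.pre k).length + 1) = search a n ((r.pair y).pre (2 * k)) (2 * k + 1) := by
    intro n k
    rw [pre_length, interleave_pre]
  refine app_ofWord (G := fun n σ => search a n (interleave (r.pre σ.length) σ)
    (2 * σ.length + 1)) (fun n k => ?_) fun n => ?_
  · obtain ⟨k', h1, h2⟩ := hz n
    rw [key, search_eq h1 h2 (2 * k) (2 * k + 1) le_rfl]
    by_cases h : k' < 2 * k + 1 <;> simp [h]
  · obtain ⟨k', h1, h2⟩ := hz n
    refine ⟨k', ?_⟩
    rw [key, search_eq h1 h2 (2 * k') (2 * k' + 1) le_rfl, if_pos (by omega)]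
    exact Nat.succ_ne_zero _

/-- The word made of the entries of `σ` at the odd positions below `2 * j`. -/
def oddPart (σ : List ℕ) (j : ℕ) : List ℕ := (List.range j).map fun i => σ.getD (2 * i + 1) 0

theorem oddPart_pre (p q : Baire) {j L : ℕ} (h : 2 * j ≤ L) :
    oddPart ((p.pair q).pre L) j = q.pre j := by
  unfold oddPart
  refine List.map_congr_left (g := q) fun i hi => ?_
  have hi := List.mem_range.1 hi
  rw [getD_pre _ (by omega), Baire.pair_odd]

theorem oddPart_primrec : Primrec₂ oddPart := by
  refine Primrec.list_map (f := fun x : List ℕ × ℕ => List.range x.2)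
    (g := fun x i => x.1.getD (2 * i + 1) 0) (Primrec.list_range.comp Primrec.snd) ?_
  exact (Primrec.list_getD 0).comp (Primrec.fst.comp Primrec.fst)
    (Primrec.succ.comp (Primrec.nat_mul.comp (Primrec.const 2) Primrec.snd))

/-- The search for the value at `n` of `e · y`, when a prefix `σ` of the pair of `e` and `y` is
known: after `K` steps, the state is `0` if the search goes on, `1` if it needs an entry of `e` that
is not in `σ`, and `v + 1` if the non-zero value `v` has been found. -/
def evalState (n : ℕ) (σ : List ℕ) (K : ℕ) : ℕ :=
  Nat.rec 0 (fun j r => Nat.casesOn r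
    (Option.casesOn (σ[2 * Encodable.encode (n :: oddPart σ j)]?) 1
      fun v => Nat.casesOn v 0 fun w => w + 2) fun m => m + 1) K

theorem evalState_primrec : Primrec fun x : (ℕ × List ℕ) × ℕ => evalState x.1.1 x.1.2 x.2 := by
  refine Primrec.nat_rec' (f := fun x : (ℕ × List ℕ) × ℕ => x.2) (g := fun _ => 0)
    (h := fun x y => Nat.casesOn y.2
      (Option.casesOn (x.1.2[2 * Encodable.encode (x.1.1 :: oddPart x.1.2 y.1)]?) 1
      fun v => Nat.casesOn v 0 fun w => w + 2) fun m => m + 1) Primrec.snd (Primrec.const 0) ?_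
  refine Primrec.nat_casesOn (f := fun z : ((ℕ × List ℕ) × ℕ) × (ℕ × ℕ) => z.2.2)
    (g := fun z => Option.casesOn
      (z.1.1.2[2 * Encodable.encode (z.1.1.1 :: oddPart z.1.1.2 z.2.1)]?) 1
      fun v => Nat.casesOn v 0 fun w => w + 2)
    (h := fun _ m => m + 1) (Primrec.snd.comp Primrec.snd) ?_ (Primrec.succ.comp Primrec.snd)
  have hσ : Primrec fun z : ((ℕ × List ℕ) × ℕ) × (ℕ × ℕ) => z.1.1.2 :=
    Primrec.snd.comp (Primrec.fst.comp Primrec.fst)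
  refine Primrec.option_casesOn
    (o := fun z : ((ℕ × List ℕ) × ℕ) × (ℕ × ℕ) =>
      z.1.1.2[2 * Encodable.encode (z.1.1.1 :: oddPart z.1.1.2 z.2.1)]?)
    (f := fun _ => 1) (g := fun _ v => Nat.casesOn v 0 fun w => w + 2) ?_ (Primrec.const 1) ?_
  · refine Primrec.list_getElem?.comp hσ (Primrec.nat_mul.comp (Primrec.const 2)
      (Primrec.encode.comp (Primrec.list_cons.comp ?_ (oddPart_primrec.comp hσ ?_))))
    · exact Primrec.fst.comp (Primrec.fst.comp Primrec.fst)
    · exact Primrec.fst.comp Primrec.snd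
  · exact Primrec.nat_casesOn Primrec.snd (Primrec.const 0)
      (Primrec.succ.comp (Primrec.succ.comp Primrec.snd))

theorem evalState_succ (n : ℕ) (σ : List ℕ) (K : ℕ) :
    evalState n σ (K + 1) = Nat.casesOn (evalState n σ K)
    (Option.casesOn (σ[2 * Encodable.encode (n :: oddPart σ K)]?) 1
      fun v => Nat.casesOn v 0 fun w => w + 2) fun m => m + 1 := rfl

/-- In the first `L / 2 + 1` steps of the search, only known entries of `y` are read, so that the
state is either undecided or correct. -/
theorem evalState_cases {e y z : Baire} {n k : ℕ}
    (hk : e (Encodable.encode (n :: y.pre k)) = z n + 1)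
    (hj : ∀ j < k, e (Encodable.encode (n :: y.pre j)) = 0) (L K : ℕ) (hK : 2 * K ≤ L + 2) :
    (K ≤ k ∧ evalState n ((e.pair y).pre L) K = 0) ∨ evalState n ((e.pair y).pre L) K = 1 ∨
      evalState n ((e.pair y).pre L) K = z n + 2 := by
  induction K with
  | zero => exact Or.inl ⟨Nat.zero_le _, rfl⟩
  | succ K ih =>
    rw [evalState_succ, oddPart_pre e y (by omega), pre_getElem?, Baire.pair_even]
    rcases ih (by omega) with ⟨hle, h⟩ | h | h
    · rw [h]
      by_cases hlt : 2 * Encodable.encode (n :: y.pre K) < L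
      · simp only [if_pos hlt]
        rcases hle.lt_or_eq with hKk | rfl
        · rw [hj K hKk]; exact Or.inl ⟨hKk, rfl⟩
        · rw [hk]; exact Or.inr (Or.inr rfl)
      · simp only [if_neg hlt]
        exact Or.inr (Or.inl rfl)
    · rw [h]; exact Or.inr (Or.inl rfl)
    · rw [h]; exact Or.inr (Or.inr rfl)

/-- If the prefix contains the entries of `e` that determine the value, then the search succeeds. -/
theorem evalState_of_large {e y z : Baire} {n k : ℕ}
    (hk : e (Encodable.encode (n :: y.pre k)) = z n + 1)
    (hj : ∀ j < k, e (Encodable.encode (n :: y.pre j)) = 0) (L K : ℕ) (hK : 2 * K ≤ L + 2)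
    (hL : ∀ j ≤ k, 2 * Encodable.encode (n :: y.pre j) < L) :
    evalState n ((e.pair y).pre L) K = if K ≤ k then 0 else z n + 2 := by
  induction K with
  | zero => rfl
  | succ K ih =>
    rw [evalState_succ, oddPart_pre e y (by omega), pre_getElem?, Baire.pair_even, ih (by omega)]
    rcases lt_trichotomy K k with h | rfl | h
    · rw [if_pos h.le, if_pos (hL K h.le), hj K h, if_pos (Nat.succ_le_of_lt h)]; rfl
    · rw [if_pos le_rfl, if_pos (hL K le_rfl), hk, if_neg (Nat.not_succ_le_self K)]; rfl
    · rw [if_neg (Nat.not_le_of_lt h), if_neg (show ¬K + 1 ≤ k by omega)]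

/-- Application is computable: there is a computable universal code. -/
theorem exists_universal :
    ∃ u : Baire, Computable u ∧ ∀ e y z, K2App e y z → K2App u (e.pair y) z := by
  refine ⟨ofWord fun n σ => (evalState n σ (σ.length / 2 + 1)).pred, ?_, fun e y z h => ?_⟩
  · apply ofWord_computable
    refine Primrec.to_comp (Primrec.pred.comp (evalState_primrec.comp (Primrec.pair
      (Primrec.pair Primrec.fst Primrec.snd) (Primrec.succ.comp (Primrec.nat_div.comp
        (Primrec.list_length.comp Primrec.snd) (Primrec.const 2))))))
  · apply app_ofWord
    · intro n L
      obtain ⟨k, hk, hj⟩ := h n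
      rw [pre_length]
      rcases evalState_cases hk hj L (L / 2 + 1) (by omega) with ⟨-, h⟩ | h | h <;> simp [h]
    · intro n
      obtain ⟨k, hk, hj⟩ := h n
      -- A prefix long enough to contain the first `k` entries of `y` and the relevant ones of `e`.
      let L := 2 * k + ∑ j ∈ Finset.range (k + 1), (2 * Encodable.encode (n :: y.pre j) + 1)
      have hL : ∀ j ≤ k, 2 * Encodable.encode (n :: y.pre j) < L := fun j hjk =>
        (Nat.lt_succ_self _).trans_le ((Finset.single_le_sum
          (f := fun j => 2 * Encodable.encode (n :: y.pre j) + 1) (fun _ _ => Nat.zero_le _)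
          (Finset.mem_range.mpr (Nat.lt_succ_of_le hjk))).trans (Nat.le_add_left _ _))
      refine ⟨L, ?_⟩
      have h2k : 2 * k ≤ L := Nat.le_add_right _ _
      rw [pre_length, evalState_of_large hk hj L (L / 2 + 1) (by omega) hL, if_neg (by omega)]
      simp

theorem exists_pair {a b : Baire} (ha : Computable a) (hb : Computable b) :
    ∃ c : Baire, Computable c ∧
      ∀ p q s : Baire, K2App a p q → K2App b p s → K2App c p (q.pair s) := by
  refine ⟨ofWord fun n σ => if n % 2 = 0 then a (Encodable.encode (n / 2 :: σ))
    else b (Encodable.encode (n / 2 :: σ)), ?_, fun p q s hq hs n => ?_⟩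
  · apply ofWord_computable
    have hw : Computable fun x : ℕ × List ℕ => Encodable.encode (x.1 / 2 :: x.2) :=
      (Primrec.encode.comp (Primrec.list_cons.comp
        (Primrec.nat_div.comp Primrec.fst (Primrec.const 2)) Primrec.snd)).to_comp
    have hc : Computable fun x : ℕ × List ℕ => decide (x.1 % 2 = 0) :=
      (Primrec.eq.decide.comp (Primrec.nat_mod.comp Primrec.fst (Primrec.const 2))
        (Primrec.const 0)).to_comp
    refine (Computable.cond hc (ha.comp hw) (hb.comp hw)).of_eq fun x => ?_
    by_cases h : x.1 % 2 = 0 <;> simp [h]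
  · simp only [ofWord_encode, Baire.pair]
    by_cases h : n % 2 = 0
    · simpa only [if_pos h] using hq (n / 2)
    · simpa only [if_neg h] using hs (n / 2)

theorem exists_cases {a b : Baire} (ha : Computable a) (hb : Computable b) :
    ∃ c : Baire, Computable c ∧
      ∀ p q : Baire, (K2App a p q → K2App c (p.cons 0) q) ∧
        (K2App b p q → K2App c (p.cons 1) q) := by
  let G : ℕ → List ℕ → ℕ := fun n σ => Nat.casesOn σ.length 0 fun _ => Nat.casesOn σ.headI
    (a (Encodable.encode (n :: σ.tail))) fun _ => b (Encodable.encode (n :: σ.tail))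
  have hG : Computable₂ G := by
    have hw : Computable fun x : ℕ × List ℕ => Encodable.encode (x.1 :: x.2.tail) :=
      (Primrec.encode.comp (Primrec.list_cons.comp Primrec.fst
        (Primrec.list_tail.comp Primrec.snd))).to_comp
    have hc : Computable fun x : ℕ × List ℕ => (Nat.casesOn x.2.headI
        (a (Encodable.encode (x.1 :: x.2.tail)))
        fun _ => b (Encodable.encode (x.1 :: x.2.tail)) : ℕ) :=
      Computable.nat_casesOn (f := fun x : ℕ × List ℕ => x.2.headI)
        (g := fun x => a (Encodable.encode (x.1 :: x.2.tail)))
        (h := fun x _ => b (Encodable.encode (x.1 :: x.2.tail)))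
        (Primrec.list_headI.comp Primrec.snd).to_comp (ha.comp hw)
        ((hb.comp hw).comp Computable.fst)
    have hc' := (hc.comp (Computable.fst (β := ℕ))).to₂
    exact Computable.nat_casesOn (f := fun x : ℕ × List ℕ => x.2.length) (g := fun _ => 0)
      (Computable.list_length.comp Computable.snd) (Computable.const 0) hc'
  have key : ∀ (t : ℕ) (d p q : Baire),
      (∀ n σ, G n (t :: σ) = d (Encodable.encode (n :: σ))) →
        K2App d p q → K2App (ofWord G) (p.cons t) q := by
    intro t d p q hd h n
    have hpre : ∀ k, (p.cons t).pre (k + 1) = t :: p.pre k := by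
      intro k
      simp [Baire.pre, List.range_succ_eq_map, Baire.cons, Function.comp_def]
    obtain ⟨k, hk, hj⟩ := h n
    refine ⟨k + 1, by rw [ofWord_encode, hpre, hd, hk], fun j hjk => ?_⟩
    rw [ofWord_encode]
    cases j with
    | zero => rfl
    | succ j => rw [hpre, hd]; exact hj j (by omega)
  exact ⟨ofWord G, ofWord_computable hG, fun p q =>
    ⟨key 0 a p q fun _ _ => rfl, key 1 b p q fun _ _ => rfl⟩⟩

namespace ComputableFrom

variable {ι : Sort*} {a b c d : ι → Baire}

theorem refl (a : ι → Baire) : ComputableFrom a a := by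
  obtain ⟨e, he, h⟩ := exists_select id Computable.id
  exact ⟨e, he, fun i => h (a i)⟩

theorem trans (h : ComputableFrom a b) (h' : ComputableFrom b c) : ComputableFrom a c := by
  obtain ⟨e, he, h⟩ := h
  obtain ⟨e', he', h'⟩ := h'
  obtain ⟨f, hf, hc⟩ := exists_comp he' he
  exact ⟨f, hf, fun i => hc _ _ _ (h i) (h' i)⟩

theorem reindex {κ : Sort*} (h : ComputableFrom a b) (f : κ → ι) :
    ComputableFrom (fun k => a (f k)) (fun k => b (f k)) := by
  obtain ⟨e, he, h⟩ := h
  exact ⟨e, he, fun k => h (f k)⟩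

theorem select (s : ℕ → ℕ) (hs : Computable s) (a : ι → Baire) :
    ComputableFrom a (fun i n => a i (s n)) := by
  obtain ⟨e, he, h⟩ := exists_select s hs
  exact ⟨e, he, fun i => h (a i)⟩

theorem fst (h : ComputableFrom a (fun i => (b i).pair (c i))) : ComputableFrom a b := by
  refine h.trans ?_
  convert select (fun n => 2 * n)
    (Primrec.nat_mul.comp (Primrec.const 2) Primrec.id).to_comp _ using 3
  exact (Baire.pair_even _ _ _).symm

theorem snd (h : ComputableFrom a (fun i => (b i).pair (c i))) : ComputableFrom a c := by
  refine h.trans ?_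
  convert select (fun n => 2 * n + 1)
    (Primrec.succ.comp (Primrec.nat_mul.comp (Primrec.const 2) Primrec.id)).to_comp _ using 3
  exact (Baire.pair_odd _ _ _).symm

theorem pair (h : ComputableFrom a b) (h' : ComputableFrom a c) :
    ComputableFrom a (fun i => (b i).pair (c i)) := by
  obtain ⟨e, he, h⟩ := h
  obtain ⟨e', he', h'⟩ := h'
  obtain ⟨f, hf, hc⟩ := exists_pair he he'
  exact ⟨f, hf, fun i => hc _ _ _ (h i) (h' i)⟩

theorem app (h : ComputableFrom a b) (h' : ComputableFrom a c)
    (hd : ∀ i, K2App (b i) (c i) (d i)) : ComputableFrom a d := by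
  obtain ⟨u, hu, H⟩ := exists_universal
  exact (h.pair h').trans ⟨u, hu, fun i => H _ _ _ (hd i)⟩

theorem of_code {e : Baire} (he : Computable e) (h : ComputableFrom a b)
    (hc : ∀ i, K2App e (b i) (c i)) : ComputableFrom a c :=
  h.trans ⟨e, he, hc⟩

theorem curry {κ : ι → Sort*} {y z : (i : ι) → κ i → Baire}
    (h : ComputableFrom (fun x : (i : ι) ×' κ i => (a x.1).pair (y x.1 x.2))
      (fun x => z x.1 x.2)) :
    ∃ e : ι → Baire, ComputableFrom a e ∧ ∀ i k, K2App (e i) (y i k) (z i k) := by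
  obtain ⟨f, hf, h⟩ := h
  obtain ⟨φ, hφ, H⟩ := exists_curry hf
  choose E hE hE' using H
  exact ⟨fun i => E (a i), ⟨φ, hφ, fun i => hE _⟩, fun i k => hE' _ _ _ (h ⟨i, k⟩)⟩

theorem cons (t : ℕ) (h : ComputableFrom a b) : ComputableFrom a (fun i => (b i).cons t) := by
  refine h.trans ?_
  have hH : Computable₂ fun (n : ℕ) (σ : List ℕ) => (Nat.casesOn n t fun m => σ.getD m 0 : ℕ) :=
    Computable.nat_casesOn (f := fun x : ℕ × List ℕ => x.1) (g := fun _ => t)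
      (h := fun x m => x.2.getD m 0) Computable.fst (Computable.const t)
      ((Primrec.list_getD 0).comp (Primrec.snd.comp Primrec.fst) Primrec.snd).to_comp.to₂
  obtain ⟨e, he, H⟩ := exists_of_modulus (M := fun n => n) Computable.id hH
  refine ⟨e, he, fun i => ?_⟩
  convert H (b i) using 1
  funext n
  cases n with
  | zero => rfl
  | succ n => exact (getD_pre (b i) (Nat.lt_succ_self n)).symm

/-- Definition by cases on the tag of a tagged sequence. -/
theorem cases {ι : Type*} {a b : ι → Baire} {t : ι → ℕ} (ht : ∀ i, t i = 0 ∨ t i = 1)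
    (h₀ : ComputableFrom (fun i : {i // t i = 0} => a i) (fun i => b i))
    (h₁ : ComputableFrom (fun i : {i // t i = 1} => a i) (fun i => b i)) :
    ComputableFrom (fun i => (a i).cons (t i)) b := by
  obtain ⟨e, he, h₀⟩ := h₀
  obtain ⟨e', he', h₁⟩ := h₁
  obtain ⟨f, hf, hc⟩ := exists_cases he he'
  refine ⟨f, hf, fun i => ?_⟩
  rcases ht i with h | h
  · simpa only [h] using (hc _ _).1 (h₀ ⟨i, h⟩)
  · simpa only [h] using (hc _ _).2 (h₁ ⟨i, h⟩)

/-- A tag on the second component of a pair can be moved to the whole pair. The tag is at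
position `1` of the pair, and the entry at position `m + 1` of the result is at position `m` or
`m + 2` of the pair, according to the parity of `m`. -/
theorem tag_pair (t : ι → ℕ) (a b : ι → Baire) :
    ComputableFrom (fun i => (a i).pair ((b i).cons (t i))) (fun i => ((a i).pair (b i)).cons (t i))
    := by
  have hs : Primrec fun n : ℕ => (Nat.casesOn n 1 fun m => if m % 2 = 0 then m else m + 2 : ℕ) := by
    refine Primrec.nat_casesOn Primrec.id (Primrec.const 1) (Primrec.ite ?_ ?_ ?_)
    · exact Primrec.eq.comp (Primrec.nat_mod.comp Primrec.snd (Primrec.const 2)) (Primrec.const 0)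
    · exact Primrec.snd
    · exact Primrec.succ.comp (Primrec.succ.comp Primrec.snd)
  convert select _ hs.to_comp _ using 3 with i n
  cases n with
  | zero => rfl
  | succ m =>
    by_cases h : m % 2 = 0
    · simp [Baire.cons, Baire.pair, h]
    · have h' : (m + 2) / 2 = m / 2 + 1 := by omega
      simp [Baire.cons, Baire.pair, h, h']

end ComputableFrom

end K2

/-! ### Containers over a category of projectives -/

/-- A functor that preserves one pullback of a cospan preserves all of them. -/
theorem isPullback_map_of_isPullback {C : Type*} {D : Type*} [Category* C] [Category* D] (F : C ⥤ D)
    {W W' X Y Z : C} {a : W ⟶ X} {b : W ⟶ Y} {a' : W' ⟶ X} {b' : W' ⟶ Y} {f : X ⟶ Z} {g : Y ⟶ Z}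
    (h : IsPullback a b f g) (hF : IsPullback (F.map a) (F.map b) (F.map f) (F.map g))
    (h' : IsPullback a' b' f g) : IsPullback (F.map a') (F.map b') (F.map f) (F.map g) := by
  refine hF.of_iso (F.mapIso (h.isoIsPullback _ _ h')) (Iso.refl _) (Iso.refl _) (Iso.refl _)
    ?_ ?_ (by simp) (by simp)
  · rw [Iso.refl_hom, Category.comp_id, F.mapIso_hom, ← F.map_comp, h.isoIsPullback_hom_fst]
  · rw [Iso.refl_hom, Category.comp_id, F.mapIso_hom, ← F.map_comp, h.isoIsPullback_hom_snd]

namespace Container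

theorem Reducible.refl {C : Type u} [Category.{v} C] (P : Arrow C) : Reducible P P :=
  ⟨𝟙 _, _, 𝟙 _, P.hom, 𝟙 _, (IsPullback.of_horiz_isIso ⟨by simp⟩), Category.id_comp _⟩

theorem Reducible.trans {C : Type u} [Category.{v} C]
    (hC : ∀ {X Y Z : C} (f : X ⟶ Z) (g : Y ⟶ Z), ∃ (W : C) (a : W ⟶ X) (b : W ⟶ Y),
      IsPullback a b f g)
    {P Q R : Arrow C} (h : Reducible P Q) (h' : Reducible Q R) : Reducible P R := by
  obtain ⟨φ, Z, y, π, ψ, hp, hψ⟩ := h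
  obtain ⟨φ', Z', y', π', ψ', hp', hψ'⟩ := h'
  obtain ⟨W, a, b, hW⟩ := hC π' φ
  refine ⟨φ ≫ φ', W, a ≫ y', b, hp.lift (a ≫ ψ') b ?_ ≫ ψ, hW.paste_horiz hp', ?_⟩
  · rw [Category.assoc, hψ', hW.w]
  · rw [Category.assoc, hψ, hp.lift_snd]

/-- What the theory of containers over a class `p` of objects of a category uses: pullbacks and
dependent products, `p` closed under pullbacks and products up to the choice of a representative,
enough regular projectives, all those in `p` being projective, and, in `p`, fibrewise coproducts
that are stable under pullback. -/
structure IsProjectiveBase {C : Type u} [Category.{v} C] (p : ObjectProperty C) : Prop where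
  exists_pullback {X Y Z : C} (f : X ⟶ Z) (g : Y ⟶ Z) :
    ∃ (W : C) (a : W ⟶ X) (b : W ⟶ Y), IsPullback a b f g
  exists_pullback_mem {X Y Z : C} (f : X ⟶ Z) (g : Y ⟶ Z) (hX : p X) (hY : p Y) :
    ∃ (W : C) (a : W ⟶ X) (b : W ⟶ Y), p W ∧ IsPullback a b f g
  exists_prod {X Y : C} (hX : p X) (hY : p Y) :
    ∃ (W : C) (a : W ⟶ X) (b : W ⟶ Y), p W ∧ Nonempty (IsLimit (BinaryFan.mk a b))
  exists_dependentProduct {A Y V : C} (α : A ⟶ Y) (Q : Y ⟶ V) :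
    ∃ (D E : C) (d : D ⟶ V) (toD : E ⟶ D) (toY : E ⟶ Y) (ε : E ⟶ A),
      IsDependentProduct α Q d toD toY ε
  exists_cover (X : C) : ∃ (W : C) (ε : W ⟶ X), p W ∧ IsRegularEpi ε
  isRegularProjective {X : C} (hX : p X) : IsRegularProjective X
  exists_coprod {X Y B : C} (f : X ⟶ B) (g : Y ⟶ B) (hX : p X) (hY : p Y) :
    ∃ (K : C) (h : K ⟶ B) (i : X ⟶ K) (j : Y ⟶ K), p K ∧ i ≫ h = f ∧ j ≫ h = g ∧
      ∀ {W : C} (φ : W ⟶ B), p W →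
        ∃ (X' Y' K' : C) (x : X' ⟶ X) (y : Y' ⟶ Y) (k : K' ⟶ K) (π : K' ⟶ W) (i' : X' ⟶ K')
          (j' : Y' ⟶ K'), p K' ∧ IsPullback x (i' ≫ π) f φ ∧ IsPullback y (j' ≫ π) g φ ∧
            IsPullback k π h φ ∧ ∀ {T : C} (α : X' ⟶ T) (β : Y' ⟶ T),
              ∃! γ : K' ⟶ T, i' ≫ γ = α ∧ j' ≫ γ = β

namespace IsProjectiveBase

variable {C : Type u} [Category.{v} C] {p : ObjectProperty C}

theorem exists_pullback_full (H : IsProjectiveBase p) {X Y Z : p.FullSubcategory} (f : X ⟶ Z)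
    (g : Y ⟶ Z) : ∃ (W : p.FullSubcategory) (a : W ⟶ X) (b : W ⟶ Y),
      IsPullback a b f g ∧ IsPullback a.hom b.hom f.hom g.hom := by
  obtain ⟨W, a, b, hW, h⟩ := H.exists_pullback_mem f.hom g.hom X.property Y.property
  refine ⟨⟨W, hW⟩, ObjectProperty.homMk a, ObjectProperty.homMk b, ?_, h⟩
  exact IsPullback.of_map p.ι (by ext; exact h.w) h

theorem isPullback_iff (H : IsProjectiveBase p) {W X Y Z : p.FullSubcategory} {a : W ⟶ X}
    {b : W ⟶ Y} {f : X ⟶ Z} {g : Y ⟶ Z} :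
    IsPullback a b f g ↔ IsPullback a.hom b.hom f.hom g.hom := by
  refine ⟨fun h => ?_, fun h => IsPullback.of_map p.ι (by ext; exact h.w) h⟩
  obtain ⟨W', a', b', h₁, h₂⟩ := H.exists_pullback_full f g
  exact isPullback_map_of_isPullback p.ι h₁ h₂ h

theorem reducible_trans (H : IsProjectiveBase p) {P Q R : Arrow p.FullSubcategory}
    (h : Reducible P Q) (h' : Reducible Q R) : Reducible P R :=
  Reducible.trans (fun f g => let ⟨W, a, b, h, _⟩ := H.exists_pullback_full f g; ⟨W, a, b, h⟩) h h'

end IsProjectiveBase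

/-- The data of a morphism from `R` to the composition product of `P : X ⟶ U` and `Q : Y ⟶ V`, with
the dependent product unfolded: a forward map `φ` to `V`, a map `θ` to `U` from the pullback `B` of
`Q` along `φ`, and a backward map from the pullback `A` of `P` along `θ`. -/
def ReducibleToComposite {C : Type u} [Category.{v} C] (R P Q : Arrow C) : Prop :=
  ∃ (φ : R.right ⟶ Q.right) (B : C) (b : B ⟶ Q.left) (a : B ⟶ R.right) (θ : B ⟶ P.right) (A : C)
    (x : A ⟶ P.left) (l : A ⟶ B) (ψ : A ⟶ R.left),
    IsPullback b a Q.hom φ ∧ IsPullback x l P.hom θ ∧ ψ ≫ R.hom = l ≫ a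

section

variable {C : Type u} [Category.{v} C] {p : ObjectProperty C}

/-- The pullback of a composition product along a map `k` from an object of `p` is obtained from the
pullback `B` of `Q` along the first component `φ` of `k` by pulling `P` back along `θ`, the
transpose of `k`. So it can be formed in `p`, although the composition product is not over `p`. -/
theorem exists_pullback_composite (H : IsProjectiveBase p) {P Q : Arrow p.FullSubcategory}
    {S : Arrow C} (hS : IsCompositionProduct (p.ι.mapArrow.obj P) (p.ι.mapArrow.obj Q) S)
    {W : p.FullSubcategory} (k : W.obj ⟶ S.right) :
    ∃ (φ : W ⟶ Q.right) (B : p.FullSubcategory) (b : B ⟶ Q.left) (a : B ⟶ W) (θ : B ⟶ P.right)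
      (A : p.FullSubcategory) (x : A ⟶ P.left) (l : A ⟶ B) (s : A.obj ⟶ S.left),
      IsPullback b a Q.hom φ ∧ IsPullback x l P.hom θ ∧ IsPullback s (l ≫ a).hom S.hom k := by
  obtain ⟨UY, π₁, π₂, -, d, E, toD, toY, ε, hD, x, l, hx, hS⟩ := hS
  let φ : W ⟶ Q.right := ObjectProperty.homMk (k ≫ d)
  obtain ⟨B, b, a, hB, hB'⟩ := H.exists_pullback_full Q.hom φ
  have hw : (a.hom ≫ k) ≫ d = b.hom ≫ Q.hom.hom := (Category.assoc _ _ _).trans hB'.w.symm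
  let e : B.obj ⟶ E := hD.1.lift (a.hom ≫ k) b.hom hw
  have he₁ : e ≫ toD = a.hom ≫ k := hD.1.lift_fst _ _ _
  have he₂ : e ≫ toY = b.hom := hD.1.lift_snd _ _ _
  have hE : IsPullback e a.hom toD k :=
    IsPullback.of_right (v₁₃ := Q.hom.hom) (h₁₂ := toY) (h₂₂ := d)
      (by rw [he₂]; exact hB') he₁ hD.1.flip
  let θ : B ⟶ P.right := ObjectProperty.homMk (e ≫ ε ≫ π₁)
  obtain ⟨A, x', l', hA, hA'⟩ := H.exists_pullback_full P.hom θ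
  have hw' : x'.hom ≫ P.hom.hom = (l'.hom ≫ e) ≫ ε ≫ π₁ :=
    hA'.w.trans (Category.assoc _ _ _).symm
  let s : A.obj ⟶ S.left := hx.lift x'.hom (l'.hom ≫ e) hw'
  have hs₁ : s ≫ x = x'.hom := hx.lift_fst _ _ _
  have hs₂ : s ≫ l = l'.hom ≫ e := hx.lift_snd _ _ _
  have hA'' : IsPullback s l'.hom l e :=
    IsPullback.of_right (v₁₃ := P.hom.hom) (h₁₂ := x) (h₂₂ := ε ≫ π₁)
      (by rw [hs₁]; exact hA') hs₂ hx
  refine ⟨φ, B, b, a, θ, A, x', l', s, hB, hA, ?_⟩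
  rw [hS]
  exact hA''.paste_vert hE

theorem exists_isSequentialProduct (H : IsProjectiveBase p) (P Q : Arrow p.FullSubcategory) :
    ∃ T, IsSequentialProduct p P Q T := by
  obtain ⟨UY, π₁, π₂, -, hUY⟩ := H.exists_prod P.right.property Q.left.property
  obtain ⟨D, E, d, toD, toY, ε, hD⟩ := H.exists_dependentProduct π₂ Q.hom.hom
  obtain ⟨L, x, l, hL⟩ := H.exists_pullback P.hom.hom (ε ≫ π₁)
  have hS : IsCompositionProduct (p.ι.mapArrow.obj P) (p.ι.mapArrow.obj Q) (Arrow.mk (l ≫ toD)) :=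
    ⟨UY, π₁, π₂, hUY, d, E, toD, toY, ε, hD, x, l, hL, rfl⟩
  obtain ⟨W, c, hW, hc⟩ := H.exists_cover D
  obtain ⟨-, B, -, a, -, A, -, l', s, -, -, hA⟩ :=
    exists_pullback_composite H hS (W := ⟨W, hW⟩) c
  exact ⟨Arrow.mk (l' ≫ a), _, hS, c, s, H.isRegularProjective hW, hc, hA⟩

/-- The universal property of a sequential product. The positions of the composition product are
those of its cover up to lifting, because the positions of `R` are projective. -/
theorem IsSequentialProduct.reducible_iff (H : IsProjectiveBase p)
    {P Q T : Arrow p.FullSubcategory} (hT : IsSequentialProduct p P Q T)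
    {R : Arrow p.FullSubcategory} : Reducible R T ↔ ReducibleToComposite R P Q := by
  obtain ⟨S, hS, ε, δ, -, hε, hδ⟩ := hT
  constructor
  · rintro ⟨φ, Z, y, π, ψ, hZ, hψ⟩
    have hZ' := (H.isPullback_iff.1 hZ).paste_horiz hδ
    obtain ⟨φ', B, b, a, θ, A, x, l, s, hB, hA, hs⟩ :=
      exists_pullback_composite H hS (φ.hom ≫ ε)
    let z : A ⟶ Z := ObjectProperty.homMk (hZ'.lift s (l ≫ a).hom hs.w)
    have hz : z ≫ π = l ≫ a := by
      ext
      exact hZ'.lift_snd _ _ _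
    exact ⟨φ', B, b, a, θ, A, x, l, z ≫ ψ, hB, hA, by rw [Category.assoc, hψ, hz]⟩
  · rintro ⟨φ, B, b, a, θ, A, x, l, ψ, hB, hA, hψ⟩
    obtain ⟨UY, π₁, π₂, ⟨hUY⟩, d, E, toD, toY, c, ⟨hE, -, hD⟩, x', l', hx, hS⟩ := hS
    obtain ⟨h, h₁, h₂⟩ := BinaryFan.IsLimit.lift' hUY θ.hom b.hom
    change h ≫ π₁ = _ at h₁
    change h ≫ π₂ = _ at h₂
    obtain ⟨k, ⟨hk, k', hk₁, hk₂, hk₃⟩, -⟩ :=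
      hD _ _ φ.hom a.hom b.hom (H.isPullback_iff.1 hB).flip h h₂
    have hB' : IsPullback k' a.hom toD k :=
      IsPullback.of_right (v₁₃ := Q.hom.hom) (h₁₂ := toY) (h₂₂ := d)
        (by rw [hk₂, hk]; exact H.isPullback_iff.1 hB) hk₁ hE.flip
    have hθ : k' ≫ c ≫ π₁ = θ.hom := by rw [← h₁, ← hk₃, Category.assoc]
    have hA₀ := H.isPullback_iff.1 hA
    let s : A.obj ⟶ S.left := hx.lift x.hom (l.hom ≫ k')
      (by rw [Category.assoc, hθ]; exact hA₀.w)
    have hs₁ : s ≫ x' = x.hom := hx.lift_fst _ _ _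
    have hs₂ : s ≫ l' = l.hom ≫ k' := hx.lift_snd _ _ _
    have hA' : IsPullback s l.hom l' k' :=
      IsPullback.of_right (v₁₃ := P.hom.hom) (h₁₂ := x') (h₂₂ := c ≫ π₁)
        (by rw [hs₁, hθ]; exact hA₀) hs₂ hx
    have hA'' : IsPullback s (l ≫ a).hom S.hom k := by
      rw [hS]
      exact hA'.paste_vert hB'
    obtain ⟨m, hm⟩ := H.isRegularProjective R.right.property ε hε k
    let t : A.obj ⟶ T.left.obj := hδ.lift s ((l ≫ a).hom ≫ m)
      (by rw [Category.assoc, hm]; exact hA''.w)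
    have ht₁ : t ≫ δ = s := hδ.lift_fst _ _ _
    have ht₂ : t ≫ T.hom.hom = (l ≫ a).hom ≫ m := hδ.lift_snd _ _ _
    have hA₃ : IsPullback t (l ≫ a).hom T.hom.hom m :=
      IsPullback.of_right (v₁₃ := S.hom) (h₁₂ := δ) (h₂₂ := ε)
        (by rw [ht₁, hm]; exact hA'') ht₂ hδ
    exact ⟨ObjectProperty.homMk m, A, ObjectProperty.homMk t, l ≫ a, ψ,
      H.isPullback_iff.2 hA₃, hψ⟩

/-- The meet of `P : X ⟶ U` and `Q : Y ⟶ V` has the positions `U × V` and, as directions, the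
fibrewise coproduct of the pullbacks of `P` and `Q` to `U × V`. -/
theorem exists_isMeet (H : IsProjectiveBase p) (P Q : Arrow p.FullSubcategory) :
    ∃ M, IsMeet Reducible P Q M := by
  obtain ⟨UV, π₁, π₂, hp, ⟨hUV⟩⟩ := H.exists_prod P.right.property Q.right.property
  let UV' : p.FullSubcategory := ⟨UV, hp⟩
  let π₁' : UV' ⟶ P.right := ObjectProperty.homMk π₁
  let π₂' : UV' ⟶ Q.right := ObjectProperty.homMk π₂
  obtain ⟨X, x, f, hX, hX'⟩ := H.exists_pullback_full P.hom π₁'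
  obtain ⟨Y, y, g, hY, hY'⟩ := H.exists_pullback_full Q.hom π₂'
  obtain ⟨K, h, i, j, hK, hi, hj, hst⟩ :=
    H.exists_coprod f.hom g.hom X.property Y.property
  let K' : p.FullSubcategory := ⟨K, hK⟩
  let i' : X ⟶ K' := ObjectProperty.homMk i
  let j' : Y ⟶ K' := ObjectProperty.homMk j
  let h' : K' ⟶ UV' := ObjectProperty.homMk h
  refine ⟨Arrow.mk h', ⟨π₁', X, x, f, i', hX, by ext; exact hi⟩,
    ⟨π₂', Y, y, g, j', hY, by ext; exact hj⟩, ?_⟩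
  rintro R ⟨φ₁, Z₁, y₁, ρ₁, ψ₁, hZ₁, hψ₁⟩ ⟨φ₂, Z₂, y₂, ρ₂, ψ₂, hZ₂, hψ₂⟩
  have hZ₁' := H.isPullback_iff.1 hZ₁
  have hZ₂' := H.isPullback_iff.1 hZ₂
  obtain ⟨(φ : R.right.obj ⟶ UV), e₁, e₂⟩ := BinaryFan.IsLimit.lift' hUV φ₁.hom φ₂.hom
  change φ ≫ π₁ = _ at e₁
  change φ ≫ π₂ = _ at e₂
  obtain ⟨X₁, Y₁, K₁, x₁, y₁, k, π, ι, κ, hK₁, hx, hy, hk, hc⟩ := hst φ R.right.property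
  have wx : (x₁ ≫ x.hom) ≫ P.hom.hom = (ι ≫ π) ≫ φ₁.hom := by
    rw [← e₁, ← Category.assoc, ← hx.w, Category.assoc, Category.assoc, hX'.w]; rfl
  have wy : (y₁ ≫ y.hom) ≫ Q.hom.hom = (κ ≫ π) ≫ φ₂.hom := by
    rw [← e₂, ← Category.assoc, ← hy.w, Category.assoc, Category.assoc, hY'.w]; rfl
  obtain ⟨ψ, ⟨d₁, d₂⟩, -⟩ := hc (hZ₁'.lift _ _ wx ≫ ψ₁.hom) (hZ₂'.lift _ _ wy ≫ ψ₂.hom)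
  have E₁ : ψ₁.hom ≫ R.hom.hom = ρ₁.hom := congrArg (fun t => t.hom) hψ₁
  have E₂ : ψ₂.hom ≫ R.hom.hom = ρ₂.hom := congrArg (fun t => t.hom) hψ₂
  have hψ : ψ ≫ R.hom.hom = π := by
    refine (hc (ι ≫ π) (κ ≫ π)).unique ⟨?_, ?_⟩ ⟨rfl, rfl⟩
    · rw [← Category.assoc, d₁, Category.assoc, E₁]
      exact hZ₁'.lift_snd _ _ _
    · rw [← Category.assoc, d₂, Category.assoc, E₂]
      exact hZ₂'.lift_snd _ _ _
  exact ⟨ObjectProperty.homMk φ, ⟨K₁, hK₁⟩, ObjectProperty.homMk k, ObjectProperty.homMk π,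
    ObjectProperty.homMk ψ, H.isPullback_iff.2 hk, by ext; exact hψ⟩

/-- Let `m` be below `a ⋆ b` and below `c`. The pullback of `m` to the object `B` of pairs of a
position of `m` and an answer to the associated question to `b` is below both `a` and `c`, so below
`a ⊓ c`, and this is a reduction of `m` to `(a ⊓ c) ⋆ b`. -/
theorem starMeetInequality (H : IsProjectiveBase p) :
    StarMeetInequality Reducible (IsSequentialProduct p) := by
  refine ⟨exists_isSequentialProduct H, exists_isMeet H, ?_⟩
  intro P Q R PQ M PR T hPQ hM hPR hT
  obtain ⟨φ, B, b, a, θ, A, x, l, ψ, hB, hA, hψ⟩ := (hPQ.reducible_iff H).1 hM.1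
  obtain ⟨φ', F, y, π, ψ', hF, hψ'⟩ := hM.2.1
  obtain ⟨N, n, r, hN, -⟩ := H.exists_pullback_full M.hom a
  obtain ⟨G, g, s, hG, -⟩ := H.exists_pullback_full π a
  have h₁ : Reducible (Arrow.mk r) P :=
    ⟨θ, A, x, l, hN.lift ψ l hψ, hA, hN.lift_snd _ _ _⟩
  have h₂ : Reducible (Arrow.mk r) R :=
    ⟨a ≫ φ', G, g ≫ y, s, hN.lift (g ≫ ψ') s (by rw [Category.assoc, hψ', hG.w]),
      hG.paste_horiz hF, hN.lift_snd _ _ _⟩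
  obtain ⟨θ', A', x', l', ψ'', hA', hψ''⟩ := hPR.2.2 _ h₁ h₂
  refine (hT.reducible_iff H).2 ⟨φ, B, b, a, θ', A', x', l', ψ'' ≫ n, hB, hA', ?_⟩
  change ψ'' ≫ r = l' at hψ''
  rw [Category.assoc, hN.w, ← Category.assoc, hψ'']

end

end Container

/-! ### Constructions on assemblies -/

namespace Assembly

open K2

/-- An element of an assembly with one of its realizers. -/
@[ext]
structure Realized (X : Assembly.{u}) : Type u where
  /-- the realizer -/
  code : Baire
  /-- the element -/
  elem : X.carrier
  realizes : X.Realizes code elem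

/-- The elements `x i` have realizers that are computable from the sequences `a i`, uniformly
in `i`. -/
def Computes (X : Assembly.{u}) {ι : Sort*} (a : ι → Baire) (x : ι → X.carrier) : Prop :=
  ∃ r : ι → Baire, ComputableFrom a r ∧ ∀ i, X.Realizes (r i) (x i)

namespace Computes

variable {X Y : Assembly.{u}} {ι : Sort*} {a b : ι → Baire} {x : ι → X.carrier}

theorem elem (X : Assembly.{u}) : X.Computes Realized.code Realized.elem :=
  ⟨_, ComputableFrom.refl _, Realized.realizes⟩

theorem of_realizes (h : ∀ i, X.Realizes (a i) (x i)) : X.Computes a x :=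
  ⟨a, ComputableFrom.refl _, h⟩

theorem of_computableFrom (h : ComputableFrom a b) (hx : X.Computes b x) : X.Computes a x :=
  let ⟨_, hr, hx⟩ := hx
  ⟨_, h.trans hr, hx⟩

theorem map (g : X ⟶ Y) (h : X.Computes a x) : Y.Computes a (fun i => Hom.fn g (x i)) := by
  obtain ⟨r, hr, hx⟩ := h
  obtain ⟨e, he, hg⟩ := Hom.tracked g
  choose s hs hy using fun i => hg (r i) (x i) (hx i)
  exact ⟨s, hr.of_code he hs, hy⟩

theorem cases {ι : Type*} {a : ι → Baire} {x : ι → X.carrier} {t : ι → ℕ}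
    (ht : ∀ i, t i = 0 ∨ t i = 1)
    (h₀ : X.Computes (fun i : {i // t i = 0} => a i) (fun i => x i))
    (h₁ : X.Computes (fun i : {i // t i = 1} => a i) (fun i => x i)) :
    X.Computes (fun i => (a i).cons (t i)) x := by
  classical
  obtain ⟨r, hr, hx⟩ := h₀
  obtain ⟨s, hs, hx'⟩ := h₁
  let b : ι → Baire := fun i =>
    if h : t i = 0 then r ⟨i, h⟩ else if h : t i = 1 then s ⟨i, h⟩ else 0
  have hb₀ : ∀ i : {i // t i = 0}, b i = r i := fun i => dif_pos i.2
  have hb₁ : ∀ i : {i // t i = 1}, b i = s i := fun i => by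
    have h := i.2
    simp [b, h]
  refine ⟨b, ComputableFrom.cases ht ?_ ?_, fun i => ?_⟩
  · simpa only [hb₀] using hr
  · simpa only [hb₁] using hs
  · rcases ht i with h | h
    · rw [hb₀ ⟨i, h⟩]; exact hx ⟨i, h⟩
    · rw [hb₁ ⟨i, h⟩]; exact hx' ⟨i, h⟩

end Computes

/-- The morphism with a given underlying map, if this map is computable on realizers. -/
def homMk {X Y : Assembly.{u}} (f : X.carrier → Y.carrier)
    (h : Y.Computes (Realized.code (X := X)) (fun x => f x.elem)) : X ⟶ Y :=
  Hom.mk f <| by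
    obtain ⟨r, ⟨e, he, hr⟩, hx⟩ := h
    exact ⟨e, he, fun s x hs => ⟨r ⟨s, x, hs⟩, hr ⟨s, x, hs⟩, hx ⟨s, x, hs⟩⟩⟩

theorem hom_ext {X Y : Assembly.{u}} {f g : X ⟶ Y} (h : ∀ x, Hom.fn f x = Hom.fn g x) : f = g :=
  Hom.ext (funext h)

theorem congr_fn {X Y : Assembly.{u}} {f g : X ⟶ Y} (h : f = g) (x : X.carrier) :
    Hom.fn f x = Hom.fn g x := by
  rw [h]

/-- The subassembly of the product `X × Y` given by a relation. -/
def rel (X Y : Assembly.{u}) (R : X.carrier → Y.carrier → Prop) : Assembly.{u} where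
  carrier := {z : X.carrier × Y.carrier // R z.1 z.2}
  Realizes r z := ∃ s t, r = Baire.pair s t ∧ X.Realizes s z.1.1 ∧ Y.Realizes t z.1.2
  exists_realizer z :=
    let ⟨s, hs⟩ := X.exists_realizer z.1.1
    let ⟨t, ht⟩ := Y.exists_realizer z.1.2
    ⟨s.pair t, s, t, rfl, hs, ht⟩

section rel

variable {X Y : Assembly.{u}} {R : X.carrier → Y.carrier → Prop}

theorem IsModest.rel (hX : X.IsModest) (hY : Y.IsModest) : (X.rel Y R).IsModest := by
  rintro _ x y ⟨s, t, rfl, hs, ht⟩ ⟨s', t', h, hs', ht'⟩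
  obtain ⟨rfl, rfl⟩ := Baire.pair_inj.1 h
  exact Subtype.ext (Prod.ext (hX _ _ _ hs hs') (hY _ _ _ ht ht'))

theorem IsPartitioned.rel (hX : X.IsPartitioned) (hY : Y.IsPartitioned) :
    (X.rel Y R).IsPartitioned := by
  rintro _ _ x ⟨s, t, rfl, hs, ht⟩ ⟨s', t', rfl, hs', ht'⟩
  rw [hX _ _ _ hs hs', hY _ _ _ ht ht']

theorem computes_rel {ι : Sort*} {a : ι → Baire} {z : ι → (X.rel Y R).carrier} :
    (X.rel Y R).Computes a z ↔
      X.Computes a (fun i => (z i).1.1) ∧ Y.Computes a (fun i => (z i).1.2) := by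
  constructor
  · rintro ⟨r, hr, hz⟩
    choose s t hst hs ht using hz
    obtain rfl : r = fun i => (s i).pair (t i) := funext hst
    exact ⟨⟨s, hr.fst, hs⟩, ⟨t, hr.snd, ht⟩⟩
  · rintro ⟨⟨s, hs, hs'⟩, ⟨t, ht, ht'⟩⟩
    exact ⟨_, hs.pair ht, fun i => ⟨_, _, rfl, hs' i, ht' i⟩⟩

/-- The first projection. -/
def rel.fst : X.rel Y R ⟶ X :=
  homMk (fun z => z.1.1) (computes_rel.1 (Computes.elem _)).1

/-- The second projection. -/
def rel.snd : X.rel Y R ⟶ Y :=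
  homMk (fun z => z.1.2) (computes_rel.1 (Computes.elem _)).2

/-- The map into `X.rel Y R` with given components. -/
def rel.lift {T : Assembly.{u}} (f : T ⟶ X) (g : T ⟶ Y)
    (h : ∀ x, R (Hom.fn f x) (Hom.fn g x)) : T ⟶ X.rel Y R :=
  homMk (fun x => ⟨(Hom.fn f x, Hom.fn g x), h x⟩)
    (computes_rel.2 ⟨(Computes.elem _).map f, (Computes.elem _).map g⟩)

theorem rel.hom_ext {T : Assembly.{u}} {f g : T ⟶ X.rel Y R} (h₁ : f ≫ rel.fst = g ≫ rel.fst)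
    (h₂ : f ≫ rel.snd = g ≫ rel.snd) : f = g :=
  Assembly.hom_ext fun x => Subtype.ext (Prod.ext
    (congr_fn h₁ x) (congr_fn h₂ x))

end rel

/-- The pullback of assemblies. -/
abbrev pullback {X Y Z : Assembly.{u}} (f : X ⟶ Z) (g : Y ⟶ Z) : Assembly.{u} :=
  X.rel Y fun x y => Hom.fn f x = Hom.fn g y

theorem isPullback {X Y Z : Assembly.{u}} (f : X ⟶ Z) (g : Y ⟶ Z) :
    IsPullback (rel.fst : pullback f g ⟶ X) rel.snd f g where
  w := hom_ext fun z => z.2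
  isLimit' := ⟨PullbackCone.IsLimit.mk _
    (fun s => rel.lift s.fst s.snd fun x => congr_fn s.condition x)
    (fun _ => rfl) (fun _ => rfl) fun _ _ h₁ h₂ => rel.hom_ext h₁ h₂⟩

/-- The elements of a pullback are the compatible pairs. -/
theorem exists_fn_of_isPullback {W X Y Z : Assembly.{u}} {a : W ⟶ X} {b : W ⟶ Y} {f : X ⟶ Z}
    {g : Y ⟶ Z} (h : IsPullback a b f g) : ∃ i : pullback f g ⟶ W,
      (∀ z, Hom.fn a (Hom.fn i z) = z.1.1 ∧ Hom.fn b (Hom.fn i z) = z.1.2) ∧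
      ∀ w hw, Hom.fn i ⟨(Hom.fn a w, Hom.fn b w), hw⟩ = w := by
  let i := h.lift rel.fst rel.snd (isPullback f g).w
  have h₁ : i ≫ a = rel.fst := h.lift_fst _ _ _
  have h₂ : i ≫ b = rel.snd := h.lift_snd _ _ _
  have hw : ∀ w, Hom.fn f (Hom.fn a w) = Hom.fn g (Hom.fn b w) := fun w =>
    congr_fn h.w w
  have h₃ : rel.lift a b hw ≫ i = 𝟙 W := by
    refine h.hom_ext ?_ ?_
    · rw [Category.assoc, h₁, Category.id_comp]; rfl
    · rw [Category.assoc, h₂, Category.id_comp]; rfl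
  exact ⟨i, fun z => ⟨congr_fn h₁ z, congr_fn h₂ z⟩,
    fun w _ => congr_fn h₃ w⟩

/-! ### Dependent products of assemblies -/

/-- A section of `α : A ⟶ Y` on the fibre of `Q : Y ⟶ V` at `base` that is tracked by some code,
computable or not. -/
structure FibreSection {A Y V : Assembly.{u}} (α : A ⟶ Y) (Q : Y ⟶ V) : Type u where
  /-- the point of the base -/
  base : V.carrier
  /-- the section -/
  fn : {y // Hom.fn Q y = base} → A.carrier
  isSection : ∀ y, Hom.fn α (fn y) = y.1
  tracked : ∃ e : Baire, ∀ y q, Y.Realizes q y.1 → ∃ z, K2App e q z ∧ A.Realizes z (fn y)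

theorem FibreSection.ext {A Y V : Assembly.{u}} {α : A ⟶ Y} {Q : Y ⟶ V} {s t : FibreSection α Q}
    (h : s.base = t.base) (h' : ∀ y hs ht, s.fn ⟨y, hs⟩ = t.fn ⟨y, ht⟩) : s = t := by
  obtain ⟨v, f, _, _⟩ := s
  obtain ⟨w, g, _, _⟩ := t
  obtain rfl : v = w := h
  obtain rfl : f = g := funext fun y => h' y.1 y.2 y.2
  rfl

/-- The dependent product `Π_Q α`: a section on a fibre is realized by the pairs of a realizer of
the point of the base and a code that tracks the section. -/
def depProd {A Y V : Assembly.{u}} (α : A ⟶ Y) (Q : Y ⟶ V) : Assembly.{u} where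
  carrier := FibreSection α Q
  Realizes r s := ∃ t e, r = Baire.pair t e ∧ V.Realizes t s.base ∧
    ∀ y q, Y.Realizes q y.1 → ∃ z, K2App e q z ∧ A.Realizes z (s.fn y)
  exists_realizer s :=
    let ⟨t, ht⟩ := V.exists_realizer s.base
    let ⟨e, he⟩ := s.tracked
    ⟨t.pair e, t, e, rfl, ht, he⟩

section depProd

variable {A Y V : Assembly.{u}} {α : A ⟶ Y} {Q : Y ⟶ V}

theorem IsModest.depProd (hA : A.IsModest) (hV : V.IsModest) : (depProd α Q).IsModest := by
  rintro _ s s' ⟨t, e, rfl, ht, he⟩ ⟨t', e', h, ht', he'⟩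
  obtain ⟨rfl, rfl⟩ := Baire.pair_inj.1 h
  refine FibreSection.ext (hV _ _ _ ht ht') fun y hs hs' => ?_
  obtain ⟨q, hq⟩ := Y.exists_realizer y
  obtain ⟨z, hz, hz₁⟩ := he ⟨y, hs⟩ q hq
  obtain ⟨z', hz', hz₂⟩ := he' ⟨y, hs'⟩ q hq
  exact hA _ _ _ hz₁ (hz.unique hz' ▸ hz₂)

/-- The projection of the dependent product. -/
def depProd.proj (α : A ⟶ Y) (Q : Y ⟶ V) : depProd α Q ⟶ V :=
  homMk FibreSection.base <| by
    choose t e h ht he using (Realized.realizes (X := depProd α Q))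
    refine ⟨t, ?_, ht⟩
    rw [show Realized.code = fun i => (t i).pair (e i) from funext h]
    exact (ComputableFrom.refl _).fst

/-- The counit of the dependent product, evaluation. -/
def depProd.eval (α : A ⟶ Y) (Q : Y ⟶ V) : pullback (depProd.proj α Q) Q ⟶ A :=
  homMk (fun z => FibreSection.fn z.1.1 ⟨z.1.2, z.2.symm⟩) <| by
    obtain ⟨⟨r, hr, hs⟩, ⟨q, hq, hy⟩⟩ :=
      computes_rel.1 (Computes.elem (pullback (depProd.proj α Q) Q))
    choose t e h ht he using hs
    choose z hz hA using fun i => he i ⟨_, i.elem.2.symm⟩ (q i) (hy i)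
    obtain rfl : r = fun i => (t i).pair (e i) := funext h
    exact ⟨z, hr.snd.app hq hz, hA⟩

/-- The adjoint transpose of a map `h` from the pullback of `Q` along `t`, by the s-m-n theorem. -/
def depProd.curry {T : Assembly.{u}} (t : T ⟶ V) (h : pullback t Q ⟶ A)
    (hα : h ≫ α = rel.snd) : T ⟶ depProd α Q := by
  have key : ∃ r e : T.Realized → Baire, ComputableFrom Realized.code r ∧
      (∀ x, V.Realizes (r x) (Hom.fn t x.elem)) ∧ ComputableFrom Realized.code e ∧
      ∀ (x : T.Realized) (y : Y.carrier) (hy : Hom.fn t x.elem = Hom.fn Q y) (q : Baire),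
        Y.Realizes q y → ∃ z, K2App (e x) q z ∧ A.Realizes z (Hom.fn h ⟨(x.elem, y), hy⟩) := by
    obtain ⟨r, hr, hr'⟩ := (Computes.elem T).map t
    let κ : T.Realized → Type u := fun x => {y : Y.Realized // Hom.fn t x.elem = Hom.fn Q y.elem}
    let z : ((x : T.Realized) ×' κ x) → (pullback t Q).carrier :=
      fun i => ⟨(i.1.elem, i.2.1.elem), i.2.2⟩
    have hz : (pullback t Q).Computes (fun i => i.1.code.pair i.2.1.code) z :=
      Computes.of_realizes fun i => ⟨_, _, rfl, i.1.realizes, i.2.1.realizes⟩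
    obtain ⟨w, hw, hw'⟩ := hz.map h
    obtain ⟨e, he, he'⟩ := ComputableFrom.curry (a := Realized.code (X := T))
      (y := fun x (k : κ x) => k.1.code) (z := fun x k => w ⟨x, k⟩) hw
    exact ⟨r, e, hr, hr', he, fun x y hy q hq =>
      ⟨_, he' x ⟨⟨q, y, hq⟩, hy⟩, hw' ⟨x, ⟨q, y, hq⟩, hy⟩⟩⟩
  exact homMk (fun x => ⟨Hom.fn t x, fun y => Hom.fn h ⟨(x, y.1), y.2.symm⟩,
    fun y => congr_fn hα ⟨(x, y.1), y.2.symm⟩, by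
      obtain ⟨r, e, -, -, -, he⟩ := key
      obtain ⟨c, hc⟩ := T.exists_realizer x
      exact ⟨e ⟨c, x, hc⟩, fun y => he ⟨c, x, hc⟩ y.1 y.2.symm⟩⟩) <| by
    obtain ⟨r, e, hr, hr', he, he'⟩ := key
    exact ⟨_, hr.pair he, fun x => ⟨_, _, rfl, hr' x, fun y => he' x y.1 y.2.symm⟩⟩

theorem isDependentProduct (α : A ⟶ Y) (Q : Y ⟶ V) :
    Container.IsDependentProduct α Q (depProd.proj α Q) rel.fst rel.snd (depProd.eval α Q) := by
  refine ⟨isPullback _ _, hom_ext fun z => FibreSection.isSection z.1.1 _, ?_⟩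
  intro T T' t a b hT h hα
  obtain ⟨i, hi, hi'⟩ := exists_fn_of_isPullback hT
  have hb : ∀ w, Hom.fn α (Hom.fn h w) = Hom.fn b w := fun w => congr_fn hα w
  have hih : (i ≫ h) ≫ α = rel.snd := hom_ext fun z => (hb _).trans (hi z).2
  have hw : ∀ w, Hom.fn t (Hom.fn a w) = Hom.fn Q (Hom.fn b w) := fun w =>
    congr_fn hT.w w
  refine ⟨depProd.curry t (i ≫ h) hih, ⟨rfl, rel.lift (a ≫ depProd.curry t (i ≫ h) hih) b hw,
    rfl, rfl, hom_ext fun w => congrArg (Hom.fn h) (hi' w (hw w))⟩, ?_⟩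
  rintro k ⟨rfl, k', h₁, h₂, h₃⟩
  -- The value at `y` of the section `k x` is the counit at `(k x, y)`, which is the image under
  -- `k'` of the point `w` of `T'` over `(x, y)`.
  refine hom_ext fun x => FibreSection.ext rfl fun y hs ht => ?_
  obtain ⟨hx, hy⟩ := hi ⟨(x, y), ht.symm⟩
  set w := Hom.fn i ⟨(x, y), ht.symm⟩
  have e₁ : (Hom.fn k' w).1.1 = Hom.fn k x :=
    (congr_fn h₁ w).trans (congrArg (Hom.fn k) hx)
  have e₂ : (Hom.fn k' w).1.2 = y := (congr_fn h₂ w).trans hy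
  have e₃ : Hom.fn k' w = ⟨(Hom.fn k x, y), hs.symm⟩ := Subtype.ext (Prod.ext e₁ e₂)
  have e₄ : Hom.fn (depProd.eval α Q) (Hom.fn k' w) = Hom.fn h w :=
    congr_fn h₃ w
  rw [e₃] at e₄
  exact e₄

end depProd

/-! ### Projective covers and images of assemblies -/

/-- The partitioned assembly of the elements of `X` with a realizer. -/
def cover (X : Assembly.{u}) : Assembly.{u} where
  carrier := X.Realized
  Realizes r x := r = x.code
  exists_realizer _ := ⟨_, rfl⟩

theorem isPartitioned_cover (X : Assembly.{u}) : X.cover.IsPartitioned :=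
  fun _ _ _ h h' => h.trans h'.symm

theorem IsModest.cover {X : Assembly.{u}} (hX : X.IsModest) : X.cover.IsModest := by
  rintro _ x y rfl h
  exact Realized.ext h (hX _ _ _ x.realizes ((show x.code = y.code from h) ▸ y.realizes))

/-- The projection of the cover. -/
def coverMap (X : Assembly.{u}) : X.cover ⟶ X :=
  homMk Realized.elem (Computes.of_realizes fun x =>
    (show x.code = x.elem.code from x.realizes) ▸ x.elem.realizes)

theorem exists_of_cover {X Z : Assembly.{u}} (f : X.cover ⟶ Z)
    (h : ∀ x y : X.Realized, x.elem = y.elem → Hom.fn f x = Hom.fn f y) :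
    ∃! g : X ⟶ Z, X.coverMap ≫ g = f := by
  choose r hr using X.exists_realizer
  let s : X.carrier → X.cover.carrier := fun x => Realized.mk (r x) x (hr x)
  have hs : ∀ x : X.Realized, Hom.fn f (s x.elem) = Hom.fn f x := fun x => h _ _ rfl
  refine ⟨homMk (fun x => Hom.fn f (s x)) ?_, hom_ext hs, fun g hg => hom_ext fun x => ?_⟩
  · simp only [hs]
    exact (Computes.of_realizes (X := X.cover) (a := Realized.code) (x := fun x => x)
      fun _ => rfl).map f
  · exact congr_fn hg (s x)

/-- The image of `e : Z ⟶ Y`, realized as a quotient of `Z`. -/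
def image {Z Y : Assembly.{u}} (e : Z ⟶ Y) : Assembly.{u} where
  carrier := {y // ∃ z, Hom.fn e z = y}
  Realizes r y := ∃ z, Hom.fn e z = y.1 ∧ Z.Realizes r z
  exists_realizer y :=
    let ⟨z, hz⟩ := y.2
    let ⟨r, hr⟩ := Z.exists_realizer z
    ⟨r, z, hz, hr⟩

section image

variable {Z Y : Assembly.{u}} (e : Z ⟶ Y)

theorem IsModest.image (hZ : Z.IsModest) : (image e).IsModest := by
  rintro _ _ _ ⟨z, hz, hr⟩ ⟨z', hz', hr'⟩
  obtain rfl := hZ _ _ _ hr hr'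
  exact Subtype.ext (hz.symm.trans hz')

/-- The quotient map onto the image. -/
def toImage : Z ⟶ image e :=
  homMk (fun z => ⟨_, z, rfl⟩) (Computes.of_realizes fun z => ⟨z.elem, rfl, z.realizes⟩)

/-- The inclusion of the image. -/
def imageMap : image e ⟶ Y :=
  homMk Subtype.val <| by
    choose z hz hr using (Realized.realizes (X := image e))
    simp only [← hz]
    exact (Computes.of_realizes hr).map e

/-- If the image of `e` is the whole codomain, with computable realizers, then partitioned
assemblies lift along `e`. -/
theorem IsPartitioned.exists_lift {X : Assembly.{u}} (hX : X.IsPartitioned) {k : Y ⟶ image e}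
    (hk : k ≫ imageMap e = 𝟙 Y) (f : X ⟶ Y) : ∃ g : X ⟶ Z, g ≫ e = f := by
  choose c hc using X.exists_realizer
  obtain ⟨r, hr, h⟩ := (Computes.elem X).map (f ≫ k)
  choose z hz hr' using h
  have hk' : ∀ x, (Hom.fn (f ≫ k) x).1 = Hom.fn f x := fun x =>
    congr_fn hk (Hom.fn f x)
  have hX' : ∀ x : X.Realized, Realized.mk (c x.elem) x.elem (hc _) = x := fun x =>
    Realized.ext (hX _ _ _ (hc _) x.realizes) rfl
  refine ⟨homMk (fun x => z ⟨c x, x, hc x⟩) ⟨r, hr, fun x => ?_⟩, hom_ext fun x => ?_⟩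
  · simpa only [hX'] using hr' x
  · exact (hz _).trans (hk' x)

end image

/-! ### Coproducts of assemblies -/

/-- The coproduct, with realizers tagged by `0` or `1`. -/
def coprod (X Y : Assembly.{u}) : Assembly.{u} where
  carrier := X.carrier ⊕ Y.carrier
  Realizes r z := (∃ s x, r = Baire.cons 0 s ∧ z = Sum.inl x ∧ X.Realizes s x) ∨
    ∃ s y, r = Baire.cons 1 s ∧ z = Sum.inr y ∧ Y.Realizes s y
  exists_realizer z := by
    rcases z with x | y
    · obtain ⟨s, hs⟩ := X.exists_realizer x
      exact ⟨_, Or.inl ⟨s, x, rfl, rfl, hs⟩⟩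
    · obtain ⟨s, hs⟩ := Y.exists_realizer y
      exact ⟨_, Or.inr ⟨s, y, rfl, rfl, hs⟩⟩

section coprod

variable {X Y : Assembly.{u}}

theorem IsModest.coprod (hX : X.IsModest) (hY : Y.IsModest) : (X.coprod Y).IsModest := by
  rintro _ _ _ (⟨s, x, rfl, rfl, hx⟩ | ⟨s, x, rfl, rfl, hx⟩)
    (⟨s', x', h, rfl, hx'⟩ | ⟨s', x', h, rfl, hx'⟩)
  · obtain ⟨-, rfl⟩ := Baire.cons_inj.1 h
    rw [hX _ _ _ hx hx']
  · exact absurd (Baire.cons_inj.1 h).1 zero_ne_one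
  · exact absurd (Baire.cons_inj.1 h).1 one_ne_zero
  · obtain ⟨-, rfl⟩ := Baire.cons_inj.1 h
    rw [hY _ _ _ hx hx']

theorem IsPartitioned.coprod (hX : X.IsPartitioned) (hY : Y.IsPartitioned) :
    (X.coprod Y).IsPartitioned := by
  rintro _ _ _ (⟨s, x, rfl, rfl, hx⟩ | ⟨s, x, rfl, rfl, hx⟩)
    (⟨s', x', rfl, h, hx'⟩ | ⟨s', x', rfl, h, hx'⟩)
  · rw [hX _ _ _ hx (Sum.inl.inj h ▸ hx')]
  · exact absurd h Sum.inl_ne_inr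
  · exact absurd h Sum.inr_ne_inl
  · rw [hY _ _ _ hx (Sum.inr.inj h ▸ hx')]

theorem Computes.inl {ι : Sort*} {a : ι → Baire} {x : ι → X.carrier} (h : X.Computes a x) :
    (X.coprod Y).Computes a (fun i => Sum.inl (x i)) :=
  let ⟨r, hr, hx⟩ := h
  ⟨_, hr.cons 0, fun i => Or.inl ⟨r i, x i, rfl, rfl, hx i⟩⟩

theorem Computes.inr {ι : Sort*} {a : ι → Baire} {y : ι → Y.carrier} (h : Y.Computes a y) :
    (X.coprod Y).Computes a (fun i => Sum.inr (y i)) :=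
  let ⟨r, hr, hy⟩ := h
  ⟨_, hr.cons 1, fun i => Or.inr ⟨r i, y i, rfl, rfl, hy i⟩⟩

/-- Definition by cases on `z`, in the presence of a parameter `w`: it suffices to compute `τ` on
any family of indices along which `z` lies in `X`, or in `Y`, from sequences that compute both the
summand and the parameter. -/
theorem Computes.sumCases {W T : Assembly.{u}} {ι : Type v} {a : ι → Baire}
    {z : ι → X.carrier ⊕ Y.carrier} {w : ι → W.carrier} {τ : ι → T.carrier}
    (hz : (X.coprod Y).Computes a z) (hw : W.Computes a w)
    (hX : ∀ {κ : Type v} (f : κ → ι) (b : κ → Baire) (x : κ → X.carrier),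
      (∀ k, z (f k) = Sum.inl (x k)) → X.Computes b x → W.Computes b (fun k => w (f k)) →
        T.Computes b (fun k => τ (f k)))
    (hY : ∀ {κ : Type v} (f : κ → ι) (b : κ → Baire) (y : κ → Y.carrier),
      (∀ k, z (f k) = Sum.inr (y k)) → Y.Computes b y → W.Computes b (fun k => w (f k)) →
        T.Computes b (fun k => τ (f k))) :
    T.Computes a τ := by
  obtain ⟨r, hr, hz⟩ := hz
  obtain ⟨p, hp, hw⟩ := hw
  have key : ∀ i, ∃ t s, r i = Baire.cons t s ∧
      ((t = 0 ∧ ∃ x, z i = Sum.inl x ∧ X.Realizes s x) ∨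
        (t = 1 ∧ ∃ y, z i = Sum.inr y ∧ Y.Realizes s y)) := by
    intro i
    rcases hz i with ⟨s, x, h, h', h''⟩ | ⟨s, x, h, h', h''⟩
    · exact ⟨0, s, h, Or.inl ⟨rfl, x, h', h''⟩⟩
    · exact ⟨1, s, h, Or.inr ⟨rfl, x, h', h''⟩⟩
  choose t s hrs ht using key
  obtain rfl : r = fun i => (s i).cons (t i) := funext hrs
  refine Computes.of_computableFrom ((hp.pair hr).trans (ComputableFrom.tag_pair t p s)) ?_
  have hps := ComputableFrom.refl fun i => (p i).pair (s i)
  refine Computes.cases (fun i => (ht i).imp And.left And.left) ?_ ?_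
  · have h₀ : ∀ i : {i // t i = 0}, ∃ x, z i = Sum.inl x ∧ X.Realizes (s i) x := fun i =>
      (ht i).elim And.right fun h => absurd (i.2.symm.trans h.1) zero_ne_one
    choose x hx hx' using h₀
    exact hX Subtype.val _ x hx ⟨_, hps.snd.reindex Subtype.val, hx'⟩
      ⟨_, hps.fst.reindex Subtype.val, fun i => hw i⟩
  · have h₁ : ∀ i : {i // t i = 1}, ∃ y, z i = Sum.inr y ∧ Y.Realizes (s i) y := fun i =>
      (ht i).elim (fun h => absurd (h.1.symm.trans i.2) zero_ne_one) And.right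
    choose y hy hy' using h₁
    exact hY Subtype.val _ y hy ⟨_, hps.snd.reindex Subtype.val, hy'⟩
      ⟨_, hps.fst.reindex Subtype.val, fun i => hw i⟩

/-- The first injection. -/
def coprod.inl : X ⟶ X.coprod Y := homMk Sum.inl (Computes.elem X).inl

/-- The second injection. -/
def coprod.inr : Y ⟶ X.coprod Y := homMk Sum.inr (Computes.elem Y).inr

/-- The map out of a coproduct with given components. -/
def coprod.desc {T : Assembly.{u}} (f : X ⟶ T) (g : Y ⟶ T) : X.coprod Y ⟶ T :=
  homMk (Sum.elim (Hom.fn f) (Hom.fn g)) <| by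
    refine Computes.sumCases (Computes.elem _) (Computes.elem _) ?_ ?_
    · intro κ k b x hx h _
      simp only [hx]
      exact h.map f
    · intro κ k b y hy h _
      simp only [hy]
      exact h.map g

variable {W B : Assembly.{u}} (f : X ⟶ B) (g : Y ⟶ B) (φ : W ⟶ B)

/-- The inclusion of the pullback of `X` into the pullback of the coproduct of `X` and `Y`. -/
def coprod.pullbackInl : pullback f φ ⟶ pullback (coprod.desc f g) φ :=
  rel.lift (rel.fst ≫ coprod.inl) rel.snd fun z => z.2

/-- The inclusion of the pullback of `Y` into the pullback of the coproduct of `X` and `Y`. -/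
def coprod.pullbackInr : pullback g φ ⟶ pullback (coprod.desc f g) φ :=
  rel.lift (rel.fst ≫ coprod.inr) rel.snd fun z => z.2

/-- Coproducts are stable under pullback. -/
theorem coprod.existsUnique_pullback_desc {T : Assembly.{u}} (α : pullback f φ ⟶ T)
    (β : pullback g φ ⟶ T) : ∃! γ : pullback (coprod.desc f g) φ ⟶ T,
      coprod.pullbackInl f g φ ≫ γ = α ∧ coprod.pullbackInr f g φ ≫ γ = β := by
  let c : (pullback (coprod.desc f g) φ).carrier → T.carrier := fun z =>
    match z with
    | ⟨(Sum.inl x, w), h⟩ => Hom.fn α ⟨(x, w), h⟩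
    | ⟨(Sum.inr y, w), h⟩ => Hom.fn β ⟨(y, w), h⟩
  have hc₁ : ∀ z x (h : z.1.1 = Sum.inl x),
      c z = Hom.fn α ⟨(x, z.1.2), (congrArg (Hom.fn (coprod.desc f g)) h).symm.trans z.2⟩ := by
    rintro ⟨⟨x' | y', w⟩, hz⟩ x h
    · obtain rfl := Sum.inl.inj h
      rfl
    · exact absurd h.symm Sum.inl_ne_inr
  have hc₂ : ∀ z y (h : z.1.1 = Sum.inr y),
      c z = Hom.fn β ⟨(y, z.1.2), (congrArg (Hom.fn (coprod.desc f g)) h).symm.trans z.2⟩ := by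
    rintro ⟨⟨x | y', w⟩, hz⟩ y h
    · exact absurd h Sum.inl_ne_inr
    · obtain rfl := Sum.inr.inj h
      rfl
  refine ⟨homMk c ?_, ⟨rfl, rfl⟩, ?_⟩
  · obtain ⟨hz, hw⟩ := computes_rel.1 (Computes.elem (pullback (coprod.desc f g) φ))
    refine Computes.sumCases hz hw ?_ ?_
    · intro κ k b x hx h h'
      simp only [fun i => hc₁ _ _ (hx i)]
      exact Computes.map α (computes_rel.2 ⟨h, h'⟩)
    · intro κ k b y hy h h'
      simp only [fun i => hc₂ _ _ (hy i)]
      exact Computes.map β (computes_rel.2 ⟨h, h'⟩)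
  · rintro γ ⟨h₁, h₂⟩
    refine hom_ext fun z => ?_
    obtain ⟨⟨x | y, w⟩, hz⟩ := z
    · exact congr_fn h₁ ⟨(x, w), hz⟩
    · exact congr_fn h₂ ⟨(y, w), hz⟩

end coprod

end Assembly

/-! ### Partitioned objects as a base of projectives -/

namespace Assembly

open Container

/-- The objects in the image of `F` are the assemblies that are modest if `q` holds: with `q` true,
all modest sets; with `q` false, all assemblies. This allows the two cases to be treated at once. -/
def HasObjects {C : Type*} [Category* C] (F : C ⥤ Assembly.{u}) (q : Prop) : Prop :=
  ∀ A : Assembly.{u}, (q → A.IsModest) ↔ ∃ c, F.obj c = A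

section

variable {C : Type*} [Category* C] (F : C ⥤ Assembly.{u}) {q : Prop} {p : ObjectProperty C}

theorem exists_isPullback_of_hasObjects (hF : HasObjects F q)
    [F.Full] [F.Faithful] {X Y Z : C} (f : X ⟶ Z) (g : Y ⟶ Z) :
    ∃ (W : C) (a : W ⟶ X) (b : W ⟶ Y),
      ((F.obj X).IsPartitioned → (F.obj Y).IsPartitioned → (F.obj W).IsPartitioned) ∧
      IsPullback a b f g ∧ IsPullback (F.map a) (F.map b) (F.map f) (F.map g) := by
  obtain ⟨P, a, b, hM, hP, h⟩ : ∃ (P : Assembly.{u}) (a : P ⟶ F.obj X) (b : P ⟶ F.obj Y),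
      (q → P.IsModest) ∧
      ((F.obj X).IsPartitioned → (F.obj Y).IsPartitioned → P.IsPartitioned) ∧
      IsPullback a b (F.map f) (F.map g) :=
    ⟨_, rel.fst, rel.snd, fun hq => .rel ((hF _).2 ⟨X, rfl⟩ hq) ((hF _).2 ⟨Y, rfl⟩ hq),
      IsPartitioned.rel, isPullback _ _⟩
  obtain ⟨W, rfl⟩ := (hF P).1 hM
  obtain ⟨a, rfl⟩ := F.map_surjective a
  obtain ⟨b, rfl⟩ := F.map_surjective b
  exact ⟨W, a, b, hP, IsPullback.of_map F (F.map_injective (by simpa using h.w)) h, h⟩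

theorem exists_prod_of_hasObjects (hF : HasObjects F q)
    [F.Full] [F.Faithful] (X Y : C) :
    ∃ (W : C) (a : W ⟶ X) (b : W ⟶ Y),
      ((F.obj X).IsPartitioned → (F.obj Y).IsPartitioned → (F.obj W).IsPartitioned) ∧
      Nonempty (IsLimit (BinaryFan.mk a b)) := by
  obtain ⟨P, a, b, hM, hP, h⟩ : ∃ (P : Assembly.{u}) (a : P ⟶ F.obj X) (b : P ⟶ F.obj Y),
      (q → P.IsModest) ∧
      ((F.obj X).IsPartitioned → (F.obj Y).IsPartitioned → P.IsPartitioned) ∧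
      ∀ {T : Assembly.{u}} (f : T ⟶ F.obj X) (g : T ⟶ F.obj Y),
        ∃! k : T ⟶ P, k ≫ a = f ∧ k ≫ b = g :=
    ⟨rel _ _ fun _ _ => True, rel.fst, rel.snd,
      fun hq => .rel ((hF _).2 ⟨X, rfl⟩ hq) ((hF _).2 ⟨Y, rfl⟩ hq), IsPartitioned.rel,
      fun f g => ⟨rel.lift f g fun _ => trivial, ⟨rfl, rfl⟩,
        fun _ h => rel.hom_ext h.1 h.2⟩⟩
  obtain ⟨W, rfl⟩ := (hF P).1 hM
  obtain ⟨a, rfl⟩ := F.map_surjective a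
  obtain ⟨b, rfl⟩ := F.map_surjective b
  have h' : ∀ {T : C} (f : T ⟶ X) (g : T ⟶ Y), ∃! k : T ⟶ W, k ≫ a = f ∧ k ≫ b = g := by
    intro T f g
    obtain ⟨k, ⟨h₁, h₂⟩, hk⟩ := h (F.map f) (F.map g)
    obtain ⟨k, rfl⟩ := F.map_surjective k
    refine ⟨k, ⟨F.map_injective (by simpa using h₁), F.map_injective (by simpa using h₂)⟩, ?_⟩
    rintro l ⟨rfl, rfl⟩
    exact F.map_injective (hk _ ⟨(F.map_comp _ _).symm, (F.map_comp _ _).symm⟩)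
  choose k hk hk' using @h'
  exact ⟨W, a, b, hP, ⟨BinaryFan.IsLimit.mk _ k (fun f g => (hk f g).1) (fun f g => (hk f g).2)
    fun f g m h₁ h₂ => hk' f g m ⟨h₁, h₂⟩⟩⟩

theorem exists_dependentProduct_of_hasObjects (hF : HasObjects F q) [F.Full] [F.Faithful]
    {A Y V : C} (α : A ⟶ Y) (Q : Y ⟶ V) :
    ∃ (D E : C) (d : D ⟶ V) (toD : E ⟶ D) (toY : E ⟶ Y) (ε : E ⟶ A),
      IsDependentProduct α Q d toD toY ε := by
  obtain ⟨D, E, d, toD, toY, ε, hD, hE, hα, hd, h⟩ :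
      ∃ (D E : Assembly.{u}) (d : D ⟶ F.obj V) (toD : E ⟶ D) (toY : E ⟶ F.obj Y)
        (ε : E ⟶ F.obj A), (q → D.IsModest) ∧ (q → E.IsModest) ∧
        IsDependentProduct (F.map α) (F.map Q) d toD toY ε := by
    have hM : q → (depProd (F.map α) (F.map Q)).IsModest := fun hq =>
      .depProd ((hF _).2 ⟨A, rfl⟩ hq) ((hF _).2 ⟨V, rfl⟩ hq)
    exact ⟨_, _, _, _, _, _, hM, fun hq => .rel (hM hq) ((hF _).2 ⟨Y, rfl⟩ hq),
      isDependentProduct _ _⟩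
  obtain ⟨D, rfl⟩ := (hF D).1 hD
  obtain ⟨E, rfl⟩ := (hF E).1 hE
  obtain ⟨d, rfl⟩ := F.map_surjective d
  obtain ⟨toD, rfl⟩ := F.map_surjective toD
  obtain ⟨toY, rfl⟩ := F.map_surjective toY
  obtain ⟨ε, rfl⟩ := F.map_surjective ε
  refine ⟨D, E, d, toD, toY, ε, IsPullback.of_map F (F.map_injective (by simpa using hα.w)) hα,
    F.map_injective (by simpa using hd), ?_⟩
  intro T T' t a b hT g hg
  obtain ⟨W, a', b', -, h₁, h₂⟩ := exists_isPullback_of_hasObjects F hF t Q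
  obtain ⟨k, ⟨hk, k', hk₁, hk₂, hk₃⟩, huniq⟩ := h _ _ (F.map t) (F.map a) (F.map b)
    (isPullback_map_of_isPullback F h₁ h₂ hT) (F.map g) (by rw [← F.map_comp, hg])
  obtain ⟨k, rfl⟩ := F.map_surjective k
  obtain ⟨k', rfl⟩ := F.map_surjective k'
  simp only [← F.map_comp] at hk hk₁ hk₂ hk₃
  refine ⟨k, ⟨F.map_injective hk, k', F.map_injective hk₁, F.map_injective hk₂,
    F.map_injective hk₃⟩, ?_⟩
  rintro l ⟨hl, l', hl₁, hl₂, hl₃⟩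
  refine F.map_injective (huniq _ ⟨?_, F.map l', ?_, ?_, ?_⟩) <;> simp only [← F.map_comp, *]

theorem exists_cover_of_hasObjects (hF : HasObjects F q)
    [F.Full] [F.Faithful] (X : C) :
    ∃ (W : C) (ε : W ⟶ X), (F.obj W).IsPartitioned ∧ IsRegularEpi ε := by
  obtain ⟨W, K, ε, a, b, hW, hK, hP, hw, h⟩ :
      ∃ (W K : Assembly.{u}) (ε : W ⟶ F.obj X) (a b : K ⟶ W), (q → W.IsModest) ∧
        (q → K.IsModest) ∧ W.IsPartitioned ∧ a ≫ ε = b ≫ ε ∧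
        ∀ {Z : Assembly.{u}} (f : W ⟶ Z), a ≫ f = b ≫ f → ∃! g : F.obj X ⟶ Z, ε ≫ g = f := by
    have hM : q → (cover (F.obj X)).IsModest := fun hq => .cover ((hF _).2 ⟨X, rfl⟩ hq)
    exact ⟨_, _, coverMap _, rel.fst, rel.snd, hM, fun hq => .rel (hM hq) (hM hq),
      isPartitioned_cover _, (isPullback (coverMap _) (coverMap _)).w,
      fun f hf => exists_of_cover f fun x y hxy => congr_fn hf ⟨(x, y), hxy⟩⟩
  obtain ⟨W, rfl⟩ := (hF W).1 hW
  obtain ⟨K, rfl⟩ := (hF K).1 hK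
  obtain ⟨ε, rfl⟩ := F.map_surjective ε
  obtain ⟨a, rfl⟩ := F.map_surjective a
  obtain ⟨b, rfl⟩ := F.map_surjective b
  have h' : ∀ {Z : C} (f : W ⟶ Z), a ≫ f = b ≫ f → ∃! g : X ⟶ Z, ε ≫ g = f := by
    intro Z f hf
    obtain ⟨g, hg, hg'⟩ := h (F.map f) (by simp only [← F.map_comp, hf])
    obtain ⟨g, rfl⟩ := F.map_surjective g
    refine ⟨g, F.map_injective (by simpa using hg), ?_⟩
    rintro l rfl
    exact F.map_injective (hg' _ (F.map_comp _ _).symm)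
  refine ⟨W, ε, hP, ⟨⟨K, a, b, F.map_injective (by simpa using hw),
    Cofork.IsColimit.mk _ (fun s => (h' s.π s.condition).choose)
      (fun s => (h' s.π s.condition).choose_spec.1) fun s m hm =>
        (h' s.π s.condition).choose_spec.2 m hm⟩⟩⟩

/-- A regular epimorphism has computable lifts of realizers, because it factors through its image
realized as a quotient. So partitioned objects lift along it. -/
theorem isRegularProjective_of_hasObjects (hF : HasObjects F q)
    [F.Full] [F.Faithful] {X : C} (hX : (F.obj X).IsPartitioned) : IsRegularProjective X := by
  intro Z Y e he f
  obtain ⟨I, t, i, hI, hti, hi, h⟩ :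
      ∃ (I : Assembly.{u}) (t : F.obj Z ⟶ I) (i : I ⟶ F.obj Y), (q → I.IsModest) ∧
        t ≫ i = F.map e ∧ Mono i ∧ ∀ k : F.obj Y ⟶ I, k ≫ i = 𝟙 _ →
          ∀ f : F.obj X ⟶ F.obj Y, ∃ g, g ≫ F.map e = f :=
    ⟨_, toImage _, imageMap _, fun hq => .image _ ((hF _).2 ⟨Z, rfl⟩ hq), rfl,
      ⟨fun _ _ h => hom_ext fun x => Subtype.ext (congr_fn h x)⟩,
      fun _ hk f => hX.exists_lift _ hk f⟩
  obtain ⟨I, rfl⟩ := (hF I).1 hI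
  obtain ⟨t, rfl⟩ := F.map_surjective t
  obtain ⟨i, rfl⟩ := F.map_surjective i
  have hti' : t ≫ i = e := F.map_injective (by simpa using hti)
  have r := he.getStruct
  have ht : r.left ≫ t = r.right ≫ t := by
    apply F.map_injective
    rw [← cancel_mono (F.map i)]
    simp only [← F.map_comp, Category.assoc, hti', r.w]
  obtain ⟨k, hk⟩ := Cofork.IsColimit.desc' r.isColimit t ht
  have hk : e ≫ k = t := hk
  have hki : k ≫ i = 𝟙 Y := by
    refine Cofork.IsColimit.hom_ext r.isColimit ?_
    change e ≫ k ≫ i = e ≫ 𝟙 Y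
    rw [← Category.assoc, hk, hti', Category.comp_id]
  obtain ⟨g, hg⟩ := h (F.map k) (by rw [← F.map_comp, hki, F.map_id]) (F.map f)
  obtain ⟨g, rfl⟩ := F.map_surjective g
  exact ⟨g, F.map_injective (by simpa using hg)⟩

theorem exists_coprod_of_hasObjects (hF : HasObjects F q)
    [F.Full] [F.Faithful] (hp : ∀ c, p c ↔ (F.obj c).IsPartitioned)
    {X Y B : C} (f : X ⟶ B) (g : Y ⟶ B) (hX : p X) (hY : p Y) :
    ∃ (K : C) (h : K ⟶ B) (i : X ⟶ K) (j : Y ⟶ K), p K ∧ i ≫ h = f ∧ j ≫ h = g ∧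
      ∀ {W : C} (φ : W ⟶ B), p W →
        ∃ (X' Y' K' : C) (x : X' ⟶ X) (y : Y' ⟶ Y) (k : K' ⟶ K) (π : K' ⟶ W) (i' : X' ⟶ K')
          (j' : Y' ⟶ K'), p K' ∧ IsPullback x (i' ≫ π) f φ ∧ IsPullback y (j' ≫ π) g φ ∧
            IsPullback k π h φ ∧ ∀ {T : C} (α : X' ⟶ T) (β : Y' ⟶ T),
              ∃! γ : K' ⟶ T, i' ≫ γ = α ∧ j' ≫ γ = β := by
  have hM : ∀ c, q → (F.obj c).IsModest := fun c => (hF _).2 ⟨c, rfl⟩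
  obtain ⟨K, h, i, j, hK, hKp, hi, hj, H⟩ :
      ∃ (K : Assembly.{u}) (h : K ⟶ F.obj B) (i : F.obj X ⟶ K) (j : F.obj Y ⟶ K),
        (q → K.IsModest) ∧ K.IsPartitioned ∧ i ≫ h = F.map f ∧ j ≫ h = F.map g ∧
        ∀ {W : Assembly.{u}} (φ : W ⟶ F.obj B), (q → W.IsModest) → W.IsPartitioned →
        ∃ (X' Y' K' : Assembly.{u}) (x : X' ⟶ F.obj X) (y : Y' ⟶ F.obj Y) (k : K' ⟶ K)
          (π : K' ⟶ W) (i' : X' ⟶ K') (j' : Y' ⟶ K'), (q → X'.IsModest) ∧ (q → Y'.IsModest) ∧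
            (q → K'.IsModest) ∧ K'.IsPartitioned ∧ IsPullback x (i' ≫ π) (F.map f) φ ∧
            IsPullback y (j' ≫ π) (F.map g) φ ∧
            IsPullback k π h φ ∧ ∀ {T : Assembly.{u}} (α : X' ⟶ T) (β : Y' ⟶ T),
              ∃! γ : K' ⟶ T, i' ≫ γ = α ∧ j' ≫ γ = β := by
    have hKM : q → (coprod (F.obj X) (F.obj Y)).IsModest := fun hq => .coprod (hM _ hq) (hM _ hq)
    have hKp := IsPartitioned.coprod ((hp _).1 hX) ((hp _).1 hY)
    exact ⟨_, coprod.desc (F.map f) (F.map g), coprod.inl, coprod.inr, hKM, hKp, rfl, rfl,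
      fun φ hW hWp => ⟨_, _, _, rel.fst, rel.fst, rel.fst, rel.snd,
        coprod.pullbackInl (F.map f) (F.map g) φ, coprod.pullbackInr (F.map f) (F.map g) φ,
        fun hq => .rel (hM _ hq) (hW hq), fun hq => .rel (hM _ hq) (hW hq),
        fun hq => .rel (hKM hq) (hW hq), hKp.rel hWp, isPullback _ _, isPullback _ _,
        isPullback _ _, coprod.existsUnique_pullback_desc _ _ _⟩⟩
  obtain ⟨K, rfl⟩ := (hF K).1 hK
  obtain ⟨h, rfl⟩ := F.map_surjective h
  obtain ⟨i, rfl⟩ := F.map_surjective i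
  obtain ⟨j, rfl⟩ := F.map_surjective j
  refine ⟨K, h, i, j, (hp _).2 hKp, F.map_injective (by simpa using hi),
    F.map_injective (by simpa using hj), fun {W} φ hW => ?_⟩
  obtain ⟨X', Y', K', x, y, k, π, i', j', hX', hY', hK', hKp', hx, hy, hk, H⟩ :=
    H (F.map φ) (hM W) ((hp _).1 hW)
  obtain ⟨X', rfl⟩ := (hF X').1 hX'
  obtain ⟨Y', rfl⟩ := (hF Y').1 hY'
  obtain ⟨K', rfl⟩ := (hF K').1 hK'
  obtain ⟨x, rfl⟩ := F.map_surjective x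
  obtain ⟨y, rfl⟩ := F.map_surjective y
  obtain ⟨k, rfl⟩ := F.map_surjective k
  obtain ⟨π, rfl⟩ := F.map_surjective π
  obtain ⟨i', rfl⟩ := F.map_surjective i'
  obtain ⟨j', rfl⟩ := F.map_surjective j'
  rw [← F.map_comp] at hx hy
  refine ⟨X', Y', K', x, y, k, π, i', j', (hp _).2 hKp',
    IsPullback.of_map F (F.map_injective (by simpa using hx.w)) hx,
    IsPullback.of_map F (F.map_injective (by simpa using hy.w)) hy,
    IsPullback.of_map F (F.map_injective (by simpa using hk.w)) hk, fun α β => ?_⟩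
  obtain ⟨γ, ⟨h₁, h₂⟩, hγ⟩ := H (F.map α) (F.map β)
  obtain ⟨γ, rfl⟩ := F.map_surjective γ
  refine ⟨γ, ⟨F.map_injective (by simpa using h₁), F.map_injective (by simpa using h₂)⟩, ?_⟩
  rintro l ⟨rfl, rfl⟩
  exact F.map_injective (hγ _ ⟨(F.map_comp _ _).symm, (F.map_comp _ _).symm⟩)

/-- In the category of assemblies, or of modest sets, the partitioned objects are a base of
projectives. -/
theorem isProjectiveBase_of_hasObjects (hF : HasObjects F q) [F.Full] [F.Faithful]
    (hp : ∀ c, p c ↔ (F.obj c).IsPartitioned) : IsProjectiveBase p where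
  exists_pullback f g :=
    let ⟨W, a, b, _, h, _⟩ := exists_isPullback_of_hasObjects F hF f g
    ⟨W, a, b, h⟩
  exists_pullback_mem f g hX hY :=
    let ⟨W, a, b, hW, h, _⟩ := exists_isPullback_of_hasObjects F hF f g
    ⟨W, a, b, (hp _).2 (hW ((hp _).1 hX) ((hp _).1 hY)), h⟩
  exists_prod {X Y} hX hY :=
    let ⟨W, a, b, hW, h⟩ := exists_prod_of_hasObjects F hF X Y
    ⟨W, a, b, (hp _).2 (hW ((hp _).1 hX) ((hp _).1 hY)), h⟩
  exists_dependentProduct := exists_dependentProduct_of_hasObjects F hF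
  exists_cover X :=
    let ⟨W, ε, hW, h⟩ := exists_cover_of_hasObjects F hF X
    ⟨W, ε, (hp _).2 hW, h⟩
  isRegularProjective hX := isRegularProjective_of_hasObjects F hF ((hp _).1 hX)
  exists_coprod f g hX hY := exists_coprod_of_hasObjects F hF hp f g hX hY

end

theorem isProjectiveBase : IsProjectiveBase Assembly.IsPartitioned.{u} :=
  isProjectiveBase_of_hasObjects (q := False) (𝟭 _)
    (fun A => ⟨fun _ => ⟨A, rfl⟩, fun _ h => h.elim⟩) fun _ => Iff.rfl

end Assembly

theorem ModestSet.isProjectiveBase : Container.IsProjectiveBase ModestSet.IsPartitioned.{u} :=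
  Assembly.isProjectiveBase_of_hasObjects (q := True) Assembly.IsModest.ι
    (fun A => ⟨fun h => ⟨⟨A, h trivial⟩, rfl⟩, fun ⟨c, hc⟩ _ => hc ▸ c.property⟩)
    fun _ => Iff.rfl

/-! ### Extended Weihrauch predicates as containers -/

namespace Assembly

theorem reducible_iff {P Q : Arrow Assembly.IsPartitioned.{u}.FullSubcategory} :
    Container.Reducible P Q ↔ ∃ (φ : P.right.obj ⟶ Q.right.obj)
      (ψ : pullback Q.hom.hom φ ⟶ P.left.obj), ψ ≫ P.hom.hom = rel.snd := by
  constructor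
  · rintro ⟨φ, Z, y, π, ψ, hZ, rfl⟩
    obtain ⟨i, hi, -⟩ := exists_fn_of_isPullback (isProjectiveBase.isPullback_iff.1 hZ)
    exact ⟨φ.hom, i ≫ ψ.hom, hom_ext fun z => (hi z).2⟩
  · rintro ⟨φ, ψ, hψ⟩
    let Z : Assembly.IsPartitioned.{u}.FullSubcategory :=
      ⟨pullback Q.hom.hom φ, .rel Q.left.property P.right.property⟩
    let y : Z ⟶ Q.left := ObjectProperty.homMk (rel.fst : pullback Q.hom.hom φ ⟶ _)
    let π : Z ⟶ P.right := ObjectProperty.homMk (rel.snd : pullback Q.hom.hom φ ⟶ _)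
    exact ⟨ObjectProperty.homMk φ, Z, y, π, ObjectProperty.homMk ψ,
      isProjectiveBase.isPullback_iff.2 (isPullback _ _), by ext1; exact hψ⟩

end Assembly

namespace ExtendedPredicate

open K2 Assembly

theorem computes_positions {p : ExtendedPredicate} {ι : Sort*} {a : ι → Baire}
    {x : ι → p.positions.carrier} :
    p.positions.Computes a x ↔ ComputableFrom a (fun i => (x i).1.1) := by
  refine ⟨?_, fun h => ⟨_, h, fun _ => rfl⟩⟩
  rintro ⟨r, hr, h⟩
  obtain rfl : r = _ := funext h
  exact hr

theorem computes_directions {p : ExtendedPredicate} {ι : Sort*} {a : ι → Baire}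
    {x : ι → p.directions.carrier} : p.directions.Computes a x ↔
      ComputableFrom a (fun i => (x i).1.1) ∧ ComputableFrom a (fun i => (x i).1.2.2) := by
  refine ⟨?_, fun h => ⟨_, h.1.pair h.2, fun _ => rfl⟩⟩
  rintro ⟨r, hr, h⟩
  obtain rfl : r = _ := funext h
  exact ⟨hr.fst, hr.snd⟩

/-- The correspondence between extended Weihrauch predicates and containers over partitioned
assemblies is an embedding of preorders. -/
theorem reducible_toContainer_iff {p q : ExtendedPredicate} :
    Container.Reducible p.toContainer q.toContainer ↔ p.Reducible q := by
  rw [Assembly.reducible_iff]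
  constructor
  · rintro ⟨φ, ψ, hψ⟩
    change p.positions ⟶ q.positions at φ
    let Z : Assembly.{0} := pullback q.toContainer.hom.hom φ
    change Z ⟶ p.directions at ψ
    obtain ⟨fwd, hfwd, hφ⟩ := computes_positions.1
      ((computes_positions.2 (ComputableFrom.refl fun x : p.positions.carrier => x.1.1)).map φ)
    let a : Z.carrier → Baire := fun z => z.1.2.1.1.pair z.1.1.1.2.2
    have ha : ComputableFrom a (fun z => (Hom.fn ψ z).1.2.2) := by
      have h₁ : ComputableFrom a fun z => z.1.2.1.1 := (ComputableFrom.refl a).fst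
      have h₂ : ComputableFrom a fun z => z.1.1.1.2.2 := (ComputableFrom.refl a).snd
      have h₃ : ∀ z : Z.carrier, z.1.1.1.1 = (Hom.fn φ z.1.2).1.1 := fun z =>
        congrArg (fun x => x.1.1) z.2
      have h₄ : ComputableFrom a fun z => z.1.1.1.1 := by
        simp only [h₃]
        exact computes_positions.1 ((computes_positions.2 h₁).map φ)
      exact (computes_directions.1 (Computes.map ψ (x := fun z => z)
        (computes_rel.2 ⟨computes_directions.2 ⟨h₄, h₂⟩, computes_positions.2 h₁⟩))).2
    obtain ⟨b, hb, hab⟩ := ha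
    obtain ⟨bwd, hbwd, hcurry⟩ := exists_curry hb
    refine ⟨fwd, bwd, hfwd, hbwd, ?_⟩
    rintro r ⟨θ₀, hθ₀⟩
    let x₀ : p.positions.carrier := ⟨(r, θ₀), hθ₀⟩
    refine ⟨(Hom.fn φ x₀).1.1, ⟨_, (Hom.fn φ x₀).2⟩, hφ x₀, fun θ hθ => ?_⟩
    let x : p.positions.carrier := ⟨(r, θ), hθ⟩
    -- The first component of `φ (r, θ)` is computed from `r`, so it does not depend on `θ`.
    have hx : (Hom.fn φ x₀).1.1 = (Hom.fn φ x).1.1 := (hφ x₀).unique (hφ x)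
    refine ⟨(Hom.fn φ x).1.2, hx ▸ (Hom.fn φ x).2, fun s hs => ?_⟩
    let z : Z.carrier := ⟨(⟨((Hom.fn φ x).1.1, (Hom.fn φ x).1.2, s), (Hom.fn φ x).2, hs⟩, x), rfl⟩
    obtain ⟨c, hc, hc'⟩ := hcurry r
    refine ⟨c, _, hc, hc' _ _ (hab z), ?_⟩
    have hz : (Hom.fn ψ z).1.2.1 = θ := congrArg (fun w => w.1.2) (congr_fn hψ z)
    exact hz ▸ (Hom.fn ψ z).2.2
  · rintro ⟨fwd, bwd, hfwd, hbwd, h⟩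
    choose r' hr' hfwd' ξ hξ c t hc ht htθ using fun x : p.positions.carrier =>
      have hx := h x.1.1 ⟨x.1.2, x.2⟩
      (⟨hx.choose, hx.choose_spec.1, hx.choose_spec.2.1, hx.choose_spec.2.2 x.1.2 x.2⟩ :
        ∃ r' ∈ q.supp, K2App fwd x.1.1 r' ∧ ∃ ξ ∈ q r', ∀ s ∈ ξ, ∃ c t : Baire,
          K2App bwd x.1.1 c ∧ K2App c s t ∧ t ∈ x.1.2)
    let φ : p.positions ⟶ q.positions := Assembly.homMk (fun x => ⟨(r' x, ξ x), hξ x⟩)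
      (computes_positions.2 ((computes_positions.1 (Computes.elem _)).of_code hfwd
        fun x => hfwd' x.elem))
    have hs : ∀ z : (pullback q.toContainer.hom.hom φ).carrier, z.1.1.1.2.2 ∈ ξ z.1.2 := fun z => by
      have h₁ : z.1.1.1.2.1 = ξ z.1.2 := congrArg (fun x => x.1.2) z.2
      exact h₁ ▸ z.1.1.2.2
    refine ⟨φ, Assembly.homMk (Y := p.directions)
      (fun z => ⟨(z.1.2.1.1, z.1.2.1.2, t z.1.2 _ (hs z)), z.1.2.2, htθ _ _ _⟩) ?_, rfl⟩
    obtain ⟨h₁, h₂⟩ := computes_rel.1 (Computes.elem (pullback q.toContainer.hom.hom φ))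
    have h₂ := computes_positions.1 h₂
    exact computes_directions.2 ⟨h₂, (h₂.of_code hbwd fun z => hc z.elem.1.2 _ (hs z.elem)).app
      (computes_directions.1 h₁).2 fun z => ht _ _ _⟩

/-- Every container over partitioned assemblies is equivalent to that of an extended Weihrauch
predicate, whose value at `r` consists of the sets of realizers of the fibres over the positions
realized by `r`. -/
theorem exists_equiv_toContainer (T : Arrow Assembly.IsPartitioned.{0}.FullSubcategory) :
    ∃ p : ExtendedPredicate,
      Container.Reducible p.toContainer T ∧ Container.Reducible T p.toContainer := by
  let fib : T.right.obj.carrier → Set Baire := fun w =>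
    {s | ∃ z, T.left.obj.Realizes s z ∧ Hom.fn T.hom.hom z = w}
  let p : ExtendedPredicate := fun r => {θ | ∃ w, T.right.obj.Realizes r w ∧ fib w = θ}
  refine ⟨p, Assembly.reducible_iff.2 ?_, Assembly.reducible_iff.2 ?_⟩
  · choose w hw hw' using fun x : p.positions.carrier => x.2
    let φ : p.positions ⟶ T.right.obj := Assembly.homMk w
      ⟨_, computes_positions.1 (Computes.elem p.positions), fun x => hw x.elem⟩
    choose s hs using T.left.obj.exists_realizer
    refine ⟨φ, Assembly.homMk (Y := p.directions)
      (fun z => ⟨(z.1.2.1.1, z.1.2.1.2, s z.1.1), z.1.2.2, ?_⟩) ?_, rfl⟩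
    · exact hw' z.1.2 ▸ ⟨z.1.1, hs _, z.2⟩
    · obtain ⟨⟨r, hr, hr'⟩, h₂⟩ := computes_rel.1 (Computes.elem (pullback T.hom.hom φ))
      obtain rfl : r = fun z => s z.elem.1.1 :=
        funext fun z => T.left.property _ _ _ (hr' z) (hs _)
      exact computes_directions.2 ⟨computes_positions.1 h₂, hr⟩
  · choose r hr using T.right.obj.exists_realizer
    let φ : T.right.obj ⟶ p.positions := Assembly.homMk
        (fun w => ⟨(r w, fib w), w, hr w, rfl⟩) <| by
      obtain ⟨c, hc, hc'⟩ := Computes.elem T.right.obj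
      obtain rfl : c = fun w => r w.elem := funext fun w => T.right.property _ _ _ (hc' w) (hr _)
      exact computes_positions.2 hc
    have hs : ∀ z : (pullback p.toContainer.hom.hom φ).carrier,
        z.1.1.1.2.2 ∈ fib z.1.2 := fun z => by
      have h₁ : z.1.1.1.2.1 = fib z.1.2 := congrArg (fun x => x.1.2) z.2
      exact h₁ ▸ z.1.1.2.2
    choose d hd hd' using hs
    refine ⟨φ, Assembly.homMk d ?_, hom_ext hd'⟩
    exact ⟨_, (computes_directions.1 (computes_rel.1
      (Computes.elem (pullback p.toContainer.hom.hom φ))).1).2, fun z => hd z.elem⟩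

theorem isMeet_toContainer {p q m : ExtendedPredicate} (h : IsMeet Reducible p q m)
    {T : Arrow Assembly.IsPartitioned.{0}.FullSubcategory}
    (hT : Container.Reducible T p.toContainer) (hT' : Container.Reducible p.toContainer T) :
    IsMeet Container.Reducible T q.toContainer m.toContainer := by
  have trans := @Assembly.isProjectiveBase.{0}.reducible_trans
  refine ⟨trans (reducible_toContainer_iff.2 h.1) hT', reducible_toContainer_iff.2 h.2.1,
    fun R hR hR' => ?_⟩
  obtain ⟨r, hr, hr'⟩ := exists_equiv_toContainer R
  exact trans hr' (reducible_toContainer_iff.2 (h.2.2 r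
    (reducible_toContainer_iff.1 (trans hr (trans hR hT)))
    (reducible_toContainer_iff.1 (trans hr hR'))))

theorem starMeetInequality : StarMeetInequality Reducible IsSequentialProduct := by
  have trans := @Assembly.isProjectiveBase.{0}.reducible_trans
  obtain ⟨hstar, hmeet, hle⟩ := Container.starMeetInequality Assembly.isProjectiveBase.{0}
  refine ⟨fun p q => ?_, fun p q => ?_, ?_⟩
  · obtain ⟨T, hT⟩ := hstar p.toContainer q.toContainer
    obtain ⟨s, hs, hs'⟩ := exists_equiv_toContainer T
    exact ⟨s, T, hT, hs, hs'⟩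
  · obtain ⟨M, hM₁, hM₂, hM⟩ := hmeet p.toContainer q.toContainer
    obtain ⟨m, hm, hm'⟩ := exists_equiv_toContainer M
    exact ⟨m, reducible_toContainer_iff.1 (trans hm hM₁),
      reducible_toContainer_iff.1 (trans hm hM₂), fun n h₁ h₂ => reducible_toContainer_iff.1
        (trans (hM _ (reducible_toContainer_iff.2 h₁) (reducible_toContainer_iff.2 h₂)) hm')⟩
  · rintro a b c ab m ac ac_b ⟨T, hT, hT₁, hT₂⟩ hm hac ⟨T', hT', -, hT'₂⟩
    exact reducible_toContainer_iff.1 (trans (hle _ _ _ T _ _ T' hT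
      (isMeet_toContainer hm hT₂ hT₁)
      (isMeet_toContainer hac (Container.Reducible.refl _) (Container.Reducible.refl _)) hT') hT'₂)

end ExtendedPredicate

/-! ### Weihrauch problems -/

namespace WeihrauchProblem

open K2

theorem mem_dom_meet {f g : WeihrauchProblem} {i : Baire} :
    i ∈ (f.meet g).dom ↔ ∃ p ∈ f.dom, ∃ q ∈ g.dom, i = p.pair q := by
  constructor
  · rintro ⟨z, p, hp, q, hq, h, -⟩
    exact ⟨p, hp, q, hq, h⟩
  · rintro ⟨p, ⟨x, hx⟩, q, hq, h⟩
    exact ⟨_, p, ⟨x, hx⟩, q, hq, h, Or.inl ⟨x, hx, rfl⟩⟩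

theorem mem_meet_pair {f g : WeihrauchProblem} {p q z : Baire} (h : z ∈ f.meet g (p.pair q)) :
    p ∈ f.dom ∧ q ∈ g.dom ∧ ((∃ x ∈ f p, z = x.cons 0) ∨ ∃ y ∈ g q, z = y.cons 1) := by
  obtain ⟨p', hp, q', hq, h, hz⟩ := h
  obtain ⟨rfl, rfl⟩ := Baire.pair_inj.1 h
  exact ⟨hp, hq, hz⟩

theorem mem_dom_star {f g : WeihrauchProblem} {w : Baire} :
    w ∈ (f.star g).dom ↔ ∃ i c : Baire, w = i.pair c ∧ i ∈ g.dom ∧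
      ∀ y ∈ g i, ∃ j ∈ f.dom, K2App c y j := by
  constructor
  · rintro ⟨z, i, c, h, hi, hc, -⟩
    exact ⟨i, c, h, hi, hc⟩
  · rintro ⟨i, c, h, ⟨y, hy⟩, hc⟩
    obtain ⟨j, ⟨x, hx⟩, hj⟩ := hc y hy
    exact ⟨_, i, c, h, ⟨y, hy⟩, hc, y, hy, j, hj, x, hx, rfl⟩

theorem mem_star_pair {f g : WeihrauchProblem} {i c z : Baire} (h : z ∈ f.star g (i.pair c)) :
    ∃ y ∈ g i, ∃ j, K2App c y j ∧ ∃ x ∈ f j, z = y.pair x := by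
  obtain ⟨i', c', h, -, -, hz⟩ := h
  obtain ⟨rfl, rfl⟩ := Baire.pair_inj.1 h
  exact hz

/-- There is a computable map `⟨⟨i, c⟩, p⟩ ↦ ⟨i, c'⟩` such that `c' · y = ⟨c · y, p⟩`. -/
theorem exists_forward : ∃ φ : Baire, Computable φ ∧ ∀ i c p : Baire, ∃ c' : Baire,
    K2App φ ((i.pair c).pair p) (i.pair c') ∧ ∀ y j, K2App c y j → K2App c' y (j.pair p) := by
  let κ : Baire × Baire × Baire → Type := fun x => {y : Baire × Baire // K2App x.2.1 y.1 y.2}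
  let a : ((x : Baire × Baire × Baire) ×' κ x) → Baire :=
    fun x => ((x.1.1.pair x.1.2.1).pair x.1.2.2).pair x.2.1.1
  have h := ComputableFrom.refl a
  obtain ⟨e, ⟨φ, hφ, he⟩, he'⟩ := ComputableFrom.curry
    (a := fun x : Baire × Baire × Baire => (x.1.pair x.2.1).pair x.2.2)
    (y := fun _ (k : κ _) => k.1.1) (z := fun x (k : κ x) => k.1.2.pair x.2.2)
    ((h.fst.fst.snd.app h.snd fun x => x.2.2).pair h.fst.snd)
  have h' := ComputableFrom.refl fun x : Baire × Baire × Baire => (x.1.pair x.2.1).pair x.2.2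
  obtain ⟨φ', hφ', H⟩ := h'.fst.fst.pair (h'.of_code hφ he)
  exact ⟨φ', hφ', fun i c p => ⟨_, H (i, c, p), fun y j hj => he' (i, c, p) ⟨(y, j), hj⟩⟩⟩

/-- There is a computable map with `⟨i, ⟨y, x⟩⟩ ↦ ⟨y, x⟩` if `x` is tagged by `0`, the tag being
moved to the pair, and `⟨i, ⟨y, x⟩⟩ ↦ x` if `x` is tagged by `1`. -/
theorem exists_backward : ∃ ψ : Baire, Computable ψ ∧ ∀ i y x : Baire,
    K2App ψ (i.pair (y.pair (x.cons 0))) ((y.pair x).cons 0) ∧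
      K2App ψ (i.pair (y.pair (x.cons 1))) (x.cons 1) := by
  let ι := {z : ℕ × Baire × Baire × Baire // z.1 = 0 ∨ z.1 = 1}
  let a : ι → Baire := fun z => z.1.2.1.pair (z.1.2.2.1.pair (z.1.2.2.2.cons z.1.1))
  let b : ι → Baire := fun z => if z.1.1 = 0 then (z.1.2.2.1.pair z.1.2.2.2).cons 0
    else z.1.2.2.2.cons 1
  have hab : ComputableFrom a b := by
    refine ((ComputableFrom.refl a).snd.trans (ComputableFrom.tag_pair _ _ _)).trans
      (ComputableFrom.cases (fun z => z.2) ?_ ?_)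
    · have hb : ∀ z : {z : ι // z.1.1 = 0}, b z = (z.1.1.2.2.1.pair z.1.1.2.2.2).cons 0 :=
        fun z => if_pos z.2
      simp only [hb]
      exact (ComputableFrom.refl _).cons 0
    · have hb : ∀ z : {z : ι // z.1.1 = 1}, b z = z.1.1.2.2.2.cons 1 :=
        fun z => if_neg (by rw [z.2]; exact one_ne_zero)
      simp only [hb]
      exact (ComputableFrom.refl _).snd.cons 1
  obtain ⟨ψ, hψ, H⟩ := hab
  exact ⟨ψ, hψ, fun i y x => ⟨H ⟨(0, i, y, x), Or.inl rfl⟩, H ⟨(1, i, y, x), Or.inr rfl⟩⟩⟩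

theorem reducible_star_meet (f g h : WeihrauchProblem) :
    Reducible ((f.star g).meet h) ((f.meet h).star g) := by
  obtain ⟨φ, hφ, H⟩ := exists_forward
  obtain ⟨ψ, hψ, H'⟩ := exists_backward
  refine ⟨φ, ψ, hφ, hψ, fun w hw => ?_⟩
  obtain ⟨_, hic, p, hp, rfl⟩ := mem_dom_meet.1 hw
  obtain ⟨i, c, rfl, hi, hc⟩ := mem_dom_star.1 hic
  obtain ⟨c', hc', hc''⟩ := H i c p
  refine ⟨i.pair c', mem_dom_star.2 ⟨i, c', rfl, hi, fun y hy => ?_⟩, hc', fun z hz => ?_⟩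
  · obtain ⟨j, hj, hj'⟩ := hc y hy
    exact ⟨_, mem_dom_meet.2 ⟨j, hj, p, hp, rfl⟩, hc'' y j hj'⟩
  · obtain ⟨y, hy, _, hj', z', hz', rfl⟩ := mem_star_pair hz
    obtain ⟨j, hj, hjc⟩ := hc y hy
    obtain rfl := hj'.unique (hc'' y j hjc)
    obtain ⟨-, -, ⟨x, hx, rfl⟩ | ⟨x, hx, rfl⟩⟩ := mem_meet_pair hz'
    · exact ⟨_, ⟨_, hic, p, hp, rfl, Or.inl ⟨y.pair x,
        ⟨i, c, rfl, hi, hc, y, hy, j, hjc, x, hx, rfl⟩, rfl⟩⟩, (H' _ y x).1⟩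
    · exact ⟨_, ⟨_, hic, p, hp, rfl, Or.inr ⟨x, hx, rfl⟩⟩, (H' _ y x).2⟩

end WeihrauchProblem

theorem mainTheorem4 :
    -- Weihrauch degrees
    (∀ f g h : WeihrauchProblem,
      WeihrauchProblem.Reducible ((f.star g).meet h) ((f.meet h).star g)) ∧
    -- extended Weihrauch degrees
    StarMeetInequality ExtendedPredicate.Reducible ExtendedPredicate.IsSequentialProduct ∧
    -- containers over partitioned modest sets, as projectives among modest sets
    StarMeetInequality Container.Reducible
      (Container.IsSequentialProduct ModestSet.IsPartitioned.{u}) ∧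
    -- containers over partitioned assemblies, as projectives among assemblies
    StarMeetInequality Container.Reducible
      (Container.IsSequentialProduct Assembly.IsPartitioned.{u}) :=
  ⟨WeihrauchProblem.reducible_star_meet, ExtendedPredicate.starMeetInequality,
    Container.starMeetInequality ModestSet.isProjectiveBase,
    Container.starMeetInequality Assembly.isProjectiveBase⟩
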